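/- Let $K\ge 2$ and $\lambda>0$, and put $\Sigma=\{1,\dots,K\}$, $p_+=\frac{e^\lambda}{e^\lambda+K-1}$, $p_-=\frac{1}{e^\lambda+K-1}$. For a horizon $H$, a generator $M$ assigns to each prompt $x$ and prefix $p\in\Sigma^{<H}$ a distribution $M(\cdot\mid x,p)$ on $\Sigma$, and $M(y\mid x)=\prod_{t\le H}M(y_t\mid x,y_{<t})$ for $y\in\Sigma^H$. For a prompt distribution $\rho$, a reward $r$ and $\beta>0$, the objective of a prompt-conditioned policy $\pi$ is $$J_\beta(\pi)=\mathbb E_{x\sim\rho}\bigl[\mathbb E_{y\sim\pi(\cdot\mid x)}r(x,y)-\beta\,\mathrm{KL}(\pi(\cdot\mid x)\,\|\,M(\cdot\mid x))\bigr],$$ an exact optimizer is a maximizer of $J_\beta$ over all policies, and the average regret of $\pi$ is $\sup_{\pi'}J_\beta(\pi')-J_\beta(\pi)$. Hard family. Let $H=D+L+1$ with $D,L\ge1$, let $x^\star$ be a prompt with mass $\eta=\rho(\{x^\star\})>0$, let $v\in\Sigma^D$, let $\tau_0\ne\tau_1$ in $\Sigma$, and let $M_{\mathrm{easy}}$ be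 a generator. For $s\in\Sigma^L$, $b\in\{0,1\}$ the instance $(s,b)$ has base generator $Q_s$ and reward $r_{s,b}$, where $Q_s=M_{\mathrm{easy}}$ at prompts $x\ne x^\star$; at $x^\star$, with $u=vs$, $Q_s(a\mid x^\star,u_{<t})$ is $p_+$ if $a=u_t$ and $p_-$ otherwise for $1\le t\le D+L$, and $Q_s(\cdot\mid x^\star,p)$ is uniform for every other prefix $p$; and $r_{s,b}(x,y)=R\,\mathbb 1\{x=x^\star,\ y=vs\tau_b\}$ with $R=\beta\log(4/q_0)$, $q_0=p_+^{D+L}/K$. Access. Algorithms are randomized and adaptive (a random seed and measurable decision rules), make finitely many queries, may interleave generator and reward queries, and output a policy. A reward query chooses a prompt $x$ and a policy $\pi$, and observes a sample $y\sim\pi(\cdot\mid x)$ and its reward $r(x,y)$. A chosen-prefix sampling query $(x,p)$ returns a draw from $M(\cdot\mid x,p)$; under the local-reset discipline, at each prompt, every queried prefix is empty, or was queried before, or extends a previously queried prefix by one token. A no-reset experiment is given by a Markov kernel $\Gamma$ not depending on the instance: a query $(x,q)$ draws $y\sim M(\cdot\mid x)$, forms $\mu_t=M(\cdot\mid x,y_{<t})$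 for $t\le H$, and returns a draw from $\Gamma_x(q,y,\mu_1,\dots,\mu_H)$. Claim. There are constants $c>1$ and $C,a>0$, depending only on $K$ and $\lambda$, such that for every $\beta>0$ and every integer $q_r\ge1$ there is $H_0$ such that for every $H\ge H_0$ there are $D,L\ge1$ with $D+L+1=H$ for which, for every prompt space with a distribution $\rho$, every prompt $x^\star$ with $\eta>0$, and all $v$, $\tau_0\neq\tau_1$, $M_{\mathrm{easy}}$, the hard family has the following two properties. 1. For every $\delta\in(0,1)$ there is an algorithm with chosen-prefix sampling access, obeying the local-reset discipline, that makes at most $C\,H\log(H/\delta)$ generator queries and at most one reward query and, on every instance $(s,b)$, outputs an exact optimizer with probability at least $1-\delta$. 2. For every no-reset experiment and every algorithm that accesses the generator only through it, makes at most $q_g$ generator queries and at most $q_r$ reward queries and, on every instance $(s,b)$, outputs with probability at least $2/3$ a policy of average regret at most $\eta\beta/4$, one has $q_g\ge a\,c^H$. -/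

import Mathlib

open MeasureTheory ProbabilityTheory
open scoped ENNReal

noncomputable section

namespace GenAccess

/-! ### Finite distributions, strings, generators -/

/-- `Δ(α)`: probability distributions on a finite set, with the Borel structure of `α → ℝ`. -/
abbrev ProbDist (α : Type*) [Fintype α] : Type _ := stdSimplex ℝ α

/-- The measure on `α` with mass function `w`. -/
def massMeasure {α : Type*} [Fintype α] [MeasurableSpace α] (w : α → ℝ) : Measure α :=
  ∑ a, ENNReal.ofReal (w a) • Measure.dirac a

/-- `Σ^H`, with the vocabulary `Σ` of size `K`. -/
abbrev Resp (K H : ℕ) : Type := Fin H → Fin K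

/-- `Σ^{<H}`: strings of length less than `H`. -/
def Prefix (K H : ℕ) : Type := {p : List (Fin K) // p.length < H}

instance (K H : ℕ) : MeasurableSpace (Prefix K H) := ⊤

instance (K H : ℕ) : DiscreteMeasurableSpace (Prefix K H) := ⟨fun _ => trivial⟩

instance (K H : ℕ) : Countable (Prefix K H) :=
  inferInstanceAs (Countable {p : List (Fin K) // p.length < H})

/-- `y_{<t}` for the position `t` (positions are numbered from `0`, so `y_{<t}` has length `t`). -/
def visited {K H : ℕ} (y : Resp K H) (t : Fin H) : Prefix K H :=
  ⟨(List.ofFn y).take t, by simp [List.length_take]⟩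

/-- A prompt-conditioned autoregressive generator `M(· | x, p)`. -/
structure Generator (X : Type*) [MeasurableSpace X] (K H : ℕ) where
  next : X → Prefix K H → ProbDist (Fin K)
  measurable_next : ∀ p, Measurable fun x => next x p

/-- `Pr_M(Y = y | x) = ∏_t M(y_t | x, y_{<t})`. -/
def Generator.respProb {X : Type*} [MeasurableSpace X] {K H : ℕ} (M : Generator X K H)
    (x : X) (y : Resp K H) : ℝ :=
  ∏ t : Fin H, (M.next x (visited y t)).1 (y t)

/-- A prompt-conditioned policy `π(· | x)`. -/
structure Policy (X : Type*) [MeasurableSpace X] (K H : ℕ) where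
  resp : X → ProbDist (Resp K H)
  measurable_resp : Measurable resp

/-! ### KL-regularized outcome-reward post-training -/

/-- A post-training instance: base generator and (bounded) outcome reward. -/
structure Instance (X : Type*) [MeasurableSpace X] (K H : ℕ) where
  base : Generator X K H
  reward : X → Resp K H → ℝ
  measurable_reward : ∀ y, Measurable fun x => reward x y
  bounded_reward : ∃ B : ℝ, ∀ x y, |reward x y| ≤ B

section Objective

variable {X : Type*} [MeasurableSpace X] {K H : ℕ}

/-- `J_β(π) = E_{x∼ρ}[E_{y∼π(·|x)} r(x,y) - β KL(π(·|x) ‖ M(·|x))]`, which is `-∞` when the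
averaged KL divergence is infinite. -/
def Instance.objective (I : Instance X K H) (ρ : Measure X) (β : ℝ) (π : Policy X K H) : EReal :=
  ((∫ x, ∑ y, (π.resp x).1 y * I.reward x y ∂ρ : ℝ) : EReal) -
    ((ENNReal.ofReal β * ∫⁻ x, InformationTheory.klDiv (massMeasure (π.resp x).1)
      (massMeasure (I.base.respProb x)) ∂ρ : ℝ≥0∞) : EReal)

/-- `π` is an exact optimizer of `J_β` among all prompt-conditioned policies. -/
def Instance.IsOptimizer (I : Instance X K H) (ρ : Measure X) (β : ℝ) (π : Policy X K H) : Prop :=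
  ∀ π' : Policy X K H, I.objective ρ β π' ≤ I.objective ρ β π

/-- The average regret `sup_{π'} J_β(π') - J_β(π)`. -/
def Instance.regret (I : Instance X K H) (ρ : Measure X) (β : ℝ) (π : Policy X K H) : EReal :=
  (⨆ π' : Policy X K H, I.objective ρ β π') - I.objective ρ β π

end Objective

/-! ### Oracles -/

theorem measurable_mixture {A B ι : Type*} [MeasurableSpace A] [MeasurableSpace B] [Fintype ι]
    {w : ι → A → ℝ} {κ : ι → A → Measure B} (hw : ∀ i, Measurable (w i))
    (hκ : ∀ i, Measurable (κ i)) :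
    Measurable fun a => ∑ i, ENNReal.ofReal (w i a) • κ i a := by
  refine Measure.measurable_of_measurable_coe _ fun s hs => ?_
  simp only [Measure.coe_finsetSum, Finset.sum_apply, Measure.smul_apply, smul_eq_mul]
  exact Finset.measurable_sum _ fun i _ =>
    (hw i).ennreal_ofReal.mul ((Measure.measurable_coe hs).comp (hκ i))

section Oracles

variable {X : Type*} [MeasurableSpace X] {K H : ℕ}

theorem Generator.measurable_next_prod (M : Generator X K H) :
    Measurable fun q : X × Prefix K H => M.next q.1 q.2 :=
  measurable_from_prod_countable_left fun p => M.measurable_next p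

/-- Chosen-prefix next-token sampling: the query `(x, p)` returns a draw from `M(· | x, p)`. -/
def prefixSample (M : Generator X K H) : Kernel (X × Prefix K H) (Fin K) where
  toFun q := massMeasure (M.next q.1 q.2).1
  measurable' := measurable_mixture
    (fun a => (measurable_pi_apply a).comp (measurable_subtype_coe.comp M.measurable_next_prod))
    (fun _ => measurable_const)

/-- A no-reset experiment with query space `Q`, reply space `Y` and reply kernel `Γ`: the query
`(x, q)` draws a rollout `y ∼ M(· | x)`, forms `μ_t = M(· | x, y_{<t})`, and draws the reply from
`Γ_x(q, y, μ_1, …, μ_H)`. The kernel `Γ` does not depend on `M`. -/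
def noReset {Q Y : Type*} [MeasurableSpace Q] [MeasurableSpace Y]
    (Γ : Kernel (X × Q × Resp K H × (Fin H → ProbDist (Fin K))) Y) (M : Generator X K H) :
    Kernel (X × Q) Y where
  toFun q := ∑ y : Resp K H, ENNReal.ofReal (M.respProb q.1 y) •
    Γ (q.1, q.2, y, fun t => M.next q.1 (visited y t))
  measurable' := by
    refine measurable_mixture (fun y => ?_) (fun y => Γ.measurable.comp ?_)
    · refine Finset.measurable_prod _ fun t _ => ?_
      exact (measurable_pi_apply (y t)).comp
        (measurable_subtype_coe.comp ((M.measurable_next (visited y t)).comp measurable_fst))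
    · refine measurable_fst.prodMk (measurable_snd.prodMk (measurable_const.prodMk ?_))
      exact measurable_pi_lambda _ fun t => (M.measurable_next (visited y t)).comp measurable_fst

/-- An outcome-reward query names a prompt `x` and the response distribution `π(· | x)` of a policy
at `x`; a completion `y ∼ π(· | x)` is sampled, and `y` and its reward `r(x, y)` are observed. -/
def rewardOracle (I : Instance X K H) : Kernel (X × ProbDist (Resp K H)) (Resp K H × ℝ) where
  toFun a := ∑ y : Resp K H, ENNReal.ofReal (a.2.1 y) • Measure.dirac (y, I.reward a.1 y)
  measurable' := measurable_mixture
    (fun y => (measurable_pi_apply y).comp (measurable_subtype_coe.comp measurable_snd))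
    (fun y => Measure.measurable_dirac.comp
      (measurable_const.prodMk ((I.measurable_reward y).comp measurable_fst)))

end Oracles

/-! ### Interactive algorithms -/

/-- What an algorithm does in one round: a generator query, a reward query, or no query. -/
abbrev Action (X GQ : Type*) (K H : ℕ) : Type _ := GQ ⊕ ((X × ProbDist (Resp K H)) ⊕ Unit)

/-- The reply received in one round. -/
abbrev Reply (GR : Type*) (K H : ℕ) : Type _ := GR ⊕ ((Resp K H × ℝ) ⊕ Unit)

/-- The reply to each possible action, given the generator oracle `G` and the reward oracle `R`. -/
def replyKernel {X GQ GR : Type*} [MeasurableSpace X] [MeasurableSpace GQ] [MeasurableSpace GR]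
    {K H : ℕ} (G : Kernel GQ GR) (R : Kernel (X × ProbDist (Resp K H)) (Resp K H × ℝ)) :
    Kernel (Action X GQ K H) (Reply GR K H) where
  toFun := Sum.elim (fun q => (G q).map Sum.inl)
    (Sum.elim (fun a => (R a).map fun o => Sum.inr (Sum.inl o))
      (fun _ => Measure.dirac (Sum.inr (Sum.inr ()))))
  measurable' := by
    refine Measurable.sumElim ((Measure.measurable_map _ measurable_inl).comp G.measurable)
      (Measurable.sumElim ((Measure.measurable_map _ ?_).comp R.measurable) measurable_const)
    exact measurable_inr.comp measurable_inl

/-- A randomized adaptive algorithm with random seed in `Ω`, generator queries in `GQ` and generator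
replies in `GR`: for finitely many rounds it acts on the seed and the replies received so far, and
finally it outputs a prompt-conditioned policy. Past actions are functions of the seed and of past
replies, so they need not be recorded. -/
structure Algorithm (Ω X GQ GR : Type*) [MeasurableSpace Ω] [MeasurableSpace X]
    [MeasurableSpace GQ] [MeasurableSpace GR] (K H : ℕ) where
  seedLaw : Measure Ω
  isProbabilityMeasure_seedLaw : IsProbabilityMeasure seedLaw
  rounds : ℕ
  act : (n : ℕ) → Ω × (Fin n → Reply GR K H) → Action X GQ K H
  measurable_act : ∀ n, Measurable (act n)
  output : (Ω × (Fin rounds → Reply GR K H)) × X → ProbDist (Resp K H)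
  measurable_output : Measurable output

namespace Algorithm

variable {Ω X GQ GR : Type*} [MeasurableSpace Ω] [MeasurableSpace X]
  [MeasurableSpace GQ] [MeasurableSpace GR] {K H : ℕ}

/-- The joint law of the seed and of the first `n` replies. -/
def lawUpTo (A : Algorithm Ω X GQ GR K H) (G : Kernel GQ GR)
    (R : Kernel (X × ProbDist (Resp K H)) (Resp K H × ℝ)) :
    (n : ℕ) → Measure (Ω × (Fin n → Reply GR K H))
  | 0 => A.seedLaw.map fun ω => (ω, Fin.elim0)
  | n + 1 => (A.lawUpTo G R n).bind fun τ =>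
      (replyKernel G R (A.act n τ)).map fun o => (τ.1, Fin.snoc τ.2 o)

/-- The joint law of the seed and of all replies. -/
def law (A : Algorithm Ω X GQ GR K H) (G : Kernel GQ GR)
    (R : Kernel (X × ProbDist (Resp K H)) (Resp K H × ℝ)) :
    Measure (Ω × (Fin A.rounds → Reply GR K H)) :=
  A.lawUpTo G R A.rounds

/-- The action taken in round `n` of a run. -/
def actionAt (A : Algorithm Ω X GQ GR K H) (τ : Ω × (Fin A.rounds → Reply GR K H))
    (n : Fin A.rounds) : Action X GQ K H :=
  A.act n (τ.1, fun i => τ.2 (Fin.castLE n.2.le i))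

/-- The policy output at the end of a run. -/
def policy (A : Algorithm Ω X GQ GR K H) (τ : Ω × (Fin A.rounds → Reply GR K H)) :
    Policy X K H where
  resp x := A.output (τ, x)
  measurable_resp := A.measurable_output.comp (measurable_const.prodMk measurable_id)

/-- The number of generator queries in a run. -/
def genCount (A : Algorithm Ω X GQ GR K H) (τ : Ω × (Fin A.rounds → Reply GR K H)) : ℕ :=
  Nat.card {n : Fin A.rounds // ∃ q, A.actionAt τ n = Sum.inl q}

/-- The number of reward queries in a run. -/
def rewardCount (A : Algorithm Ω X GQ GR K H) (τ : Ω × (Fin A.rounds → Reply GR K H)) : ℕ :=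
  Nat.card {n : Fin A.rounds // ∃ a, A.actionAt τ n = Sum.inr (Sum.inl a)}

/-- At most `g` generator queries and at most `r` reward queries, for every seed and every sequence
of replies. -/
def UsesAtMost (A : Algorithm Ω X GQ GR K H) (g r : ℕ) : Prop :=
  ∀ τ, A.genCount τ ≤ g ∧ A.rewardCount τ ≤ r

/-- The local-reset discipline, at each prompt: every queried prefix is the empty one, or was
queried before, or extends a previously queried prefix by one token. -/
def LocalReset (A : Algorithm Ω X (X × Prefix K H) GR K H) : Prop :=
  ∀ τ n x p, A.actionAt τ n = Sum.inl (x, p) → p.1 = [] ∨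
    ∃ m, m < n ∧ ∃ p', A.actionAt τ m = Sum.inl (x, p') ∧
      (p.1 = p'.1 ∨ ∃ a, p.1 = p'.1 ++ [a])

end Algorithm

/-! ### The hard family -/

/-- `p_+ = e^λ / (e^λ + K - 1)`. -/
def pPlus (K : ℕ) (lam : ℝ) : ℝ := Real.exp lam / (Real.exp lam + K - 1)

/-- `p_- = 1 / (e^λ + K - 1)`. -/
def pMinus (K : ℕ) (lam : ℝ) : ℝ := 1 / (Real.exp lam + K - 1)

theorem denom_pos {K : ℕ} (a : Fin K) (lam : ℝ) : 0 < Real.exp lam + K - 1 := by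
  have h : (1 : ℝ) ≤ K := by exact_mod_cast (Nat.succ_le_of_lt (Nat.zero_lt_of_lt a.2))
  linarith [Real.exp_pos lam]

/-- The next-token distribution with mass `p_+` at `a` and `p_-` at every other token. -/
def tilted {K : ℕ} (lam : ℝ) (a : Fin K) : ProbDist (Fin K) :=
  ⟨fun b => if b = a then pPlus K lam else pMinus K lam, by
    have hd := denom_pos a lam
    refine ⟨fun b => ?_, ?_⟩
    · simp only [pPlus, pMinus]
      split_ifs <;> positivity
    · have hK : 1 ≤ K := Nat.succ_le_of_lt (Nat.zero_lt_of_lt a.2)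
      rw [← Finset.add_sum_erase _ _ (Finset.mem_univ a), Finset.sum_congr rfl
        (fun b hb => if_neg (Finset.ne_of_mem_erase hb))]
      simp only [pPlus, pMinus, if_true, Finset.sum_const, Finset.card_erase_of_mem
        (Finset.mem_univ a), Finset.card_univ, Fintype.card_fin, nsmul_eq_mul, Nat.cast_sub hK]
      field_simp
      push_cast
      ring⟩

/-- The uniform next-token distribution. -/
def uniform (K : ℕ) [NeZero K] : ProbDist (Fin K) :=
  ⟨fun _ => 1 / K, fun _ => by positivity, by simp⟩

open scoped Classical in
/-- The next-token distributions of the hidden-path generator along `u`: at a proper prefix `u_{<t}`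
of `u` the token `u_t` is favored; every other prefix (`u` itself included) is uniform. -/
def hiddenPathNext {K H : ℕ} [NeZero K] (lam : ℝ) (u : List (Fin K)) (p : Prefix K H) :
    ProbDist (Fin K) :=
  if h : p.1 <+: u ∧ p.1.length < u.length then tilted lam (u[p.1.length]'h.2) else uniform K

section HardFamily

variable {X : Type*} [MeasurableSpace X] {K D L : ℕ} [NeZero K]

open scoped Classical in
/-- The base generator `Q_s`: the hidden path `v s` at the hard prompt, the fixed easy generator at
every other prompt. -/
def hardGenerator (lam : ℝ) {xs : X} (hxs : MeasurableSet {xs})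
    (easy : Generator X K (D + L + 1)) (v : Fin D → Fin K) (s : Fin L → Fin K) :
    Generator X K (D + L + 1) where
  next x p := if x = xs then hiddenPathNext lam (List.ofFn v ++ List.ofFn s) p else easy.next x p
  measurable_next p := Measurable.ite hxs measurable_const (easy.measurable_next p)

/-- The target completion `z_{s,b} = v s τ_b`. -/
def target (v : Fin D → Fin K) (τ : Bool → Fin K) (s : Fin L → Fin K) (b : Bool) :
    Resp K (D + L + 1) :=
  Fin.snoc (Fin.append v s) (τ b)

/-- The reward scale `R = β log (4 / q₀)`, where `q₀ = p_+^{D+L} / K` is the mass of the target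
completion under the base generator at the hard prompt. -/
def rewardScale (K D L : ℕ) (lam β : ℝ) : ℝ := β * Real.log (4 / (pPlus K lam ^ (D + L) / K))

open scoped Classical in
/-- The instance with hidden suffix `s` and reward bit `b`; its reward is
`r_{s,b}(x, y) = R 𝟙{x = x⋆, y = z_{s,b}}`. -/
def hardInstance (lam β : ℝ) {xs : X} (hxs : MeasurableSet {xs})
    (easy : Generator X K (D + L + 1)) (v : Fin D → Fin K) (τ : Bool → Fin K)
    (s : Fin L → Fin K) (b : Bool) : Instance X K (D + L + 1) where
  base := hardGenerator lam hxs easy v s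
  reward x y := if x = xs ∧ y = target v τ s b then rewardScale K D L lam β else 0
  measurable_reward y := by
    by_cases h : y = target v τ s b
    · simp only [h, and_true]
      exact Measurable.ite hxs measurable_const measurable_const
    · simp only [h, and_false, if_false]
      exact measurable_const
  bounded_reward := ⟨|rewardScale K D L lam β|, fun x y => by
    split_ifs
    · exact le_rfl
    · simp⟩

end HardFamily

end GenAccess

end

open GenAccess

noncomputable section

namespace GenAccess

/-! ### Finitely supported measures -/

section MassMeasure

variable {α : Type*} [Fintype α] [MeasurableSpace α]

/-! Objective. At every prompt other than the hard one the reward vanishes, so copying the base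
generator is optimal there. At the hard prompt the Gibbs variational principle applies. If `p` is
the mass that a policy puts on the target, the Donsker–Varadhan inequality with the exponent `log (t
/ q₀)` on the target bounds the objective by `η β (p log (4 / t) + log (1 - q₀ + t))`, for each `t >
0` (`hard_objective_le`). At `t = 4` the bound no longer depends on `p`, and the Gibbs policy
attains it, so the optimum is `η β log (5 - q₀)`. At `t = 1` it shows that regret at most `η β / 4`
forces `p > 1 / 4` (`lt_of_hard_regret_le`).

Upper bound. With local resets the hidden path is read token by token: `N` draws at the current
prefix, then one step along the plurality vote. A wrong token wins a vote at a correct prefix with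
probability at most `r ^ N`, where `r < 1` is a Bhattacharyya coefficient. A union bound over the
first error (`prob_wrong_path_le`) then allows `N` of order `log (H / δ)`. Once the path is known,
one reward query at the completion with bit `false` reveals `b`, and the Gibbs policy can be written
down (`learner_success`).

Lower bound. A rollout follows `v` with probability `p_+ ^ D`, and one that leaves `v` sees the same
distributions whatever the suffix (`hardGenerator_next_visited_congr`). Each instance is compared
with one reference run, which has a fixed suffix and zero reward. A generator query separates the
two by at most `p_+ ^ D`, a reward query by at most the mass its policy puts on the target
(`lintegral_lawUpTo_le_add`, `lintegral_reply_le_leakage`). In the sum over all `K ^ L` suffixes,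
the targets are distinct strings, so each reward query costs at most 1 and the reference run can put
mass above `1 / 4` on few targets. This gives `K ^ L * (2 / 3) ≤ 4 + q_g K ^ L p_+ ^ D + q_r`
(`two_thirds_mul_le_of_noReset`). With `D` about `H / 2` and `K ^ L ≥ 3 (4 + q_r)`, the number `q_g`
is at least of order `p_+ ^ (-H / 2)`. -/

theorem lintegral_massMeasure [MeasurableSingletonClass α] (w : α → ℝ) (f : α → ℝ≥0∞) :
    ∫⁻ a, f a ∂massMeasure w = ∑ a, ENNReal.ofReal (w a) * f a := by
  simp [massMeasure, lintegral_finsetSum_measure]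

theorem isProbabilityMeasure_massMeasure (w : ProbDist α) :
    IsProbabilityMeasure (massMeasure w.1) := by
  refine ⟨?_⟩
  simp only [massMeasure, Measure.coe_finsetSum, Finset.sum_apply, Measure.smul_apply,
    smul_eq_mul, measure_univ, mul_one]
  rw [← ENNReal.ofReal_sum_of_nonneg fun a _ => w.2.1 a, w.2.2, ENNReal.ofReal_one]

theorem massMeasure_singleton [MeasurableSingletonClass α] (w : α → ℝ) (a : α) :
    massMeasure w {a} = ENNReal.ofReal (w a) := by
  classical
  rw [← lintegral_indicator_one (measurableSet_singleton a), lintegral_massMeasure]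
  simp [Set.indicator_apply]

theorem integral_massMeasure [MeasurableSingletonClass α] (w : ProbDist α) (f : α → ℝ) :
    ∫ a, f a ∂massMeasure w.1 = ∑ a, w.1 a * f a := by
  have := isProbabilityMeasure_massMeasure w
  rw [integral_fintype Integrable.of_finite]
  refine Finset.sum_congr rfl fun a _ => ?_
  rw [measureReal_def, massMeasure_singleton, ENNReal.toReal_ofReal (w.2.1 a), smul_eq_mul]

/-- Under full support the only null set is empty. This keeps every KL divergence at the hard prompt
finite. -/
theorem absolutelyContinuous_massMeasure [MeasurableSingletonClass α] {w : α → ℝ}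
    (hw : ∀ a, 0 < w a) (μ : Measure α) : μ ≪ massMeasure w := by
  intro s hs
  have : s = ∅ := by
    by_contra hne
    obtain ⟨a, ha⟩ := Set.nonempty_iff_ne_empty.2 hne
    have h := measure_mono_null (Set.singleton_subset_iff.2 ha) hs
    rw [massMeasure_singleton, ENNReal.ofReal_eq_zero] at h
    exact absurd (hw a) h.not_gt
  simp [this]

/-- The Gibbs tilt `w e^f / ∑ w e^f` of a distribution. -/
def gibbs (w : ProbDist α) (hw : ∀ a, 0 < w.1 a) (f : α → ℝ) : ProbDist α :=
  ⟨fun a => w.1 a * Real.exp (f a) / ∑ b, w.1 b * Real.exp (f b), by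
    have hne : Nonempty α := by
      by_contra h
      rw [not_nonempty_iff] at h
      simpa using w.2.2
    have hpos : 0 < ∑ b, w.1 b * Real.exp (f b) :=
      Finset.sum_pos (fun b _ => mul_pos (hw b) (Real.exp_pos _)) Finset.univ_nonempty
    refine ⟨fun a => (div_pos (mul_pos (hw a) (Real.exp_pos _)) hpos).le, ?_⟩
    rw [← Finset.sum_div, div_self hpos.ne']⟩

theorem massMeasure_gibbs [MeasurableSingletonClass α] (w : ProbDist α) (hw : ∀ a, 0 < w.1 a)
    (f : α → ℝ) : massMeasure (gibbs w hw f).1 = (massMeasure w.1).tilted f := by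
  have := isProbabilityMeasure_massMeasure w
  refine Measure.ext_of_singleton fun a => ?_
  rw [massMeasure_singleton, tilted_apply, Measure.restrict_singleton, lintegral_smul_measure,
    lintegral_dirac, massMeasure_singleton, integral_massMeasure, smul_eq_mul,
    ← ENNReal.ofReal_mul (hw a).le, mul_div_assoc']
  rfl

/-- The Donsker–Varadhan inequality on a finite set. -/
theorem le_klDiv_massMeasure [MeasurableSingletonClass α] (π w : ProbDist α)
    (hw : ∀ a, 0 < w.1 a) (f : α → ℝ) :
    ENNReal.ofReal (∑ a, π.1 a * f a - Real.log (∑ a, w.1 a * Real.exp (f a))) ≤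
      InformationTheory.klDiv (massMeasure π.1) (massMeasure w.1) := by
  have := isProbabilityMeasure_massMeasure w
  have := isProbabilityMeasure_massMeasure π
  have hac := absolutelyContinuous_massMeasure hw (massMeasure π.1)
  have hexp : Integrable (fun x => Real.exp (f x)) (massMeasure w.1) := Integrable.of_finite
  have := isProbabilityMeasure_tilted hexp
  have hac' := hac.trans (absolutelyContinuous_tilted hexp)
  -- The inequality is nonnegativity of the divergence of `π` from the tilt of `w` by `f`, expanded
  -- through the density of the tilt.
  have hnn := InformationTheory.integral_llr_add_sub_measure_univ_nonneg hac' Integrable.of_finite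
  rw [integral_llr_tilted_right hac Integrable.of_finite hexp Integrable.of_finite,
    integral_massMeasure π f, integral_massMeasure w] at hnn
  rw [InformationTheory.klDiv_of_ac_of_integrable hac Integrable.of_finite]
  refine ENNReal.ofReal_le_ofReal ?_
  simp only [probReal_univ] at hnn ⊢
  linarith

theorem integral_llr_massMeasure_gibbs [MeasurableSingletonClass α] (w : ProbDist α)
    (hw : ∀ a, 0 < w.1 a) (f : α → ℝ) :
    ∫ a, llr (massMeasure (gibbs w hw f).1) (massMeasure w.1) a ∂massMeasure (gibbs w hw f).1 =
      ∑ a, (gibbs w hw f).1 a * f a - Real.log (∑ a, w.1 a * Real.exp (f a)) := by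
  have := isProbabilityMeasure_massMeasure w
  have := isProbabilityMeasure_massMeasure (gibbs w hw f)
  have hac := absolutelyContinuous_massMeasure hw (massMeasure (gibbs w hw f).1)
  have hexp : Integrable (fun x => Real.exp (f x)) (massMeasure w.1) := Integrable.of_finite
  have hself := integral_congr_ae (llr_self (massMeasure (gibbs w hw f).1))
  -- Only the reference measure inside the log-likelihood ratio is rewritten as a tilt; expanding it
  -- gives the formula.
  nth_rewrite 3 [massMeasure_gibbs] at hself
  rw [integral_llr_tilted_right hac Integrable.of_finite hexp Integrable.of_finite,
    integral_massMeasure _ f, integral_massMeasure w] at hself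
  simp only [Pi.zero_apply, integral_zero] at hself
  linarith

/-- This is a KL divergence. The sign is needed to undo the truncation of `ENNReal.ofReal` in
`klDiv_massMeasure_gibbs`. -/
theorem gibbs_sub_log_nonneg [MeasurableSingletonClass α] (w : ProbDist α)
    (hw : ∀ a, 0 < w.1 a) (f : α → ℝ) :
    0 ≤ ∑ a, (gibbs w hw f).1 a * f a - Real.log (∑ a, w.1 a * Real.exp (f a)) := by
  have := isProbabilityMeasure_massMeasure w
  have := isProbabilityMeasure_massMeasure (gibbs w hw f)
  have h := InformationTheory.integral_llr_add_sub_measure_univ_nonneg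
    (absolutelyContinuous_massMeasure hw (massMeasure (gibbs w hw f).1)) Integrable.of_finite
  rw [integral_llr_massMeasure_gibbs] at h
  simpa using h

theorem klDiv_massMeasure_gibbs [MeasurableSingletonClass α] (w : ProbDist α)
    (hw : ∀ a, 0 < w.1 a) (f : α → ℝ) :
    InformationTheory.klDiv (massMeasure (gibbs w hw f).1) (massMeasure w.1) =
      ENNReal.ofReal (∑ a, (gibbs w hw f).1 a * f a -
        Real.log (∑ a, w.1 a * Real.exp (f a))) := by
  have := isProbabilityMeasure_massMeasure w
  have := isProbabilityMeasure_massMeasure (gibbs w hw f)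
  rw [InformationTheory.klDiv_of_ac_of_integrable
    (absolutelyContinuous_massMeasure hw _) Integrable.of_finite, integral_llr_massMeasure_gibbs]
  simp

end MassMeasure

/-! ### Autoregressive products -/

section PathProb

variable {K : ℕ}

/-- The probability of the string `y` under the next-token weights `w`. -/
def pathProb (w : List (Fin K) → Fin K → ℝ) {n : ℕ} (y : Fin n → Fin K) : ℝ :=
  ∏ t : Fin n, w ((List.ofFn y).take t) (y t)

theorem take_ofFn_snoc {n : ℕ} (y : Fin n → Fin K) (a : Fin K) {t : ℕ} (ht : t ≤ n) :
    (List.ofFn (Fin.snoc y a : Fin (n + 1) → Fin K)).take t = (List.ofFn y).take t := by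
  rw [List.ofFn_succ_last, List.take_append_of_le_length (by simpa using ht)]
  simp

theorem pathProb_snoc (w : List (Fin K) → Fin K → ℝ) {n : ℕ} (y : Fin n → Fin K) (a : Fin K) :
    pathProb w (Fin.snoc y a : Fin (n + 1) → Fin K) = pathProb w y * w (List.ofFn y) a := by
  rw [pathProb, Fin.prod_univ_castSucc]
  congr 1
  · refine Finset.prod_congr rfl fun t _ => ?_
    rw [Fin.snoc_castSucc, Fin.val_castSucc, take_ofFn_snoc y a t.2.le]
  · simp only [Fin.val_last, Fin.snoc_last]
    rw [take_ofFn_snoc y a le_rfl, List.take_of_length_le (by simp)]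

theorem sum_pathProb_init {w : List (Fin K) → Fin K → ℝ} {n : ℕ}
    (hw : ∀ l : List (Fin K), l.length = n → ∑ a, w l a = 1) (g : (Fin n → Fin K) → ℝ) :
    ∑ y : Fin (n + 1) → Fin K, pathProb w y * g (Fin.init y) =
      ∑ y : Fin n → Fin K, pathProb w y * g y := by
  rw [← (Fin.snocEquiv fun _ : Fin (n + 1) => Fin K).sum_comp, Fintype.sum_prod_type,
    Finset.sum_comm]
  refine Finset.sum_congr rfl fun y _ => ?_
  have h : ∀ a, pathProb w (Fin.snoc y a : Fin (n + 1) → Fin K) *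
      g (Fin.init (Fin.snoc y a : Fin (n + 1) → Fin K)) = pathProb w y * g y * w (List.ofFn y) a := by
    intro a
    rw [pathProb_snoc, Fin.init_snoc]
    ring
  refine (Finset.sum_congr rfl fun a _ => h a).trans ?_
  rw [← Finset.mul_sum, hw _ (by simp), mul_one]

/-- Summing out the last token removes its factor; after `m` rounds only the law of the first `D`
tokens is left. -/
theorem sum_pathProb_castAdd {w : List (Fin K) → Fin K → ℝ} (D m : ℕ)
    (hw : ∀ l : List (Fin K), l.length < D + m → ∑ a, w l a = 1) (g : (Fin D → Fin K) → ℝ) :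
    ∑ y : Fin (D + m) → Fin K, pathProb w y * g (fun i => y (Fin.castAdd m i)) =
      ∑ y : Fin D → Fin K, pathProb w y * g y := by
  induction m with
  | zero => rfl
  | succ m ih =>
    rw [← ih fun l hl => hw l (by omega)]
    exact sum_pathProb_init (n := D + m) (fun l hl => hw l (by omega))
      fun y => g fun i => y (Fin.castAdd m i)

variable {X : Type*} [MeasurableSpace X] {H : ℕ}

/-- A short string as a prefix. -/
def toPrefix (l : List (Fin K)) (h : l.length < H) : Prefix K H := ⟨l, h⟩

/-- The next-token weights of a generator at a prompt, extended by `0` to long strings. -/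
def Generator.weights (M : Generator X K H) (x : X) (l : List (Fin K)) (a : Fin K) : ℝ :=
  if h : l.length < H then (M.next x (toPrefix l h)).1 a else 0

theorem Generator.sum_weights (M : Generator X K H) (x : X) {l : List (Fin K)}
    (hl : l.length < H) : ∑ a, M.weights x l a = 1 := by
  simp only [weights, dif_pos hl]
  exact (M.next x (toPrefix l hl)).2.2

theorem Generator.respProb_eq (M : Generator X K H) (x : X) (y : Resp K H) :
    M.respProb x y = pathProb (M.weights x) y := by
  refine Finset.prod_congr rfl fun t _ => ?_
  have h : ((List.ofFn y).take t).length < H := (visited y t).2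
  rw [weights, dif_pos h]
  rfl

theorem Generator.respProb_nonneg (M : Generator X K H) (x : X) (y : Resp K H) :
    0 ≤ M.respProb x y :=
  Finset.prod_nonneg fun t _ => (M.next x (visited y t)).2.1 _

theorem Generator.sum_respProb (M : Generator X K H) (x : X) : ∑ y, M.respProb x y = 1 := by
  have key : ∀ H' : ℕ, H' ≤ H → ∑ y : Fin H' → Fin K, pathProb (M.weights x) y = 1 := by
    intro H' hH'
    induction H' with
    | zero => simp [pathProb]
    | succ n ih =>
      rw [← ih (by omega)]
      simpa using sum_pathProb_init (w := M.weights x) (n := n)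
        (fun l hl => M.sum_weights x (by omega)) fun _ => 1
  simpa only [M.respProb_eq] using key H le_rfl

/-- The response distribution of a generator. -/
def Generator.respDist (M : Generator X K H) (x : X) : ProbDist (Resp K H) :=
  ⟨M.respProb x, M.respProb_nonneg x, M.sum_respProb x⟩

theorem Generator.measurable_respDist (M : Generator X K H) : Measurable M.respDist := by
  refine Measurable.subtype_mk (measurable_pi_lambda _ fun y => ?_)
  exact Finset.measurable_prod _ fun t _ =>
    (measurable_pi_apply (y t)).comp (measurable_subtype_coe.comp (M.measurable_next (visited y t)))

end PathProb

/-! ### The hidden-path generator at the hard prompt -/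

section HardPrompt

variable {K : ℕ}

theorem pMinus_pos [NeZero K] (lam : ℝ) : 0 < pMinus K lam :=
  one_div_pos.2 (denom_pos (0 : Fin K) lam)

theorem pPlus_pos [NeZero K] (lam : ℝ) : 0 < pPlus K lam :=
  div_pos (Real.exp_pos _) (denom_pos (0 : Fin K) lam)

theorem pPlus_lt_one (hK : 2 ≤ K) (lam : ℝ) : pPlus K lam < 1 := by
  have h2 : (2 : ℝ) ≤ K := by exact_mod_cast hK
  rw [pPlus, div_lt_one (by linarith [Real.exp_pos lam])]
  linarith

theorem hiddenPathNext_pos {H : ℕ} [NeZero K] (lam : ℝ) (u : List (Fin K)) (p : Prefix K H)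
    (a : Fin K) : 0 < (hiddenPathNext lam u p).1 a := by
  unfold hiddenPathNext
  split_ifs with h
  · simp only [tilted]
    split_ifs
    · exact pPlus_pos lam
    · exact pMinus_pos lam
  · have : 0 < K := Nat.pos_of_neZero K
    simp only [uniform]
    positivity

theorem hiddenPathNext_take {H : ℕ} [NeZero K] (lam : ℝ) (u : List (Fin K)) (p : Prefix K H)
    (t : ℕ) (hp : p.1 = u.take t) (ht : t < u.length) :
    hiddenPathNext lam u p = tilted lam u[t] := by
  have hlen : p.1.length = t := by rw [hp, List.length_take]; omega
  unfold hiddenPathNext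
  rw [dif_pos ⟨hp ▸ List.take_prefix _ _, by omega⟩]
  simp only [hlen]

variable {X : Type*} [MeasurableSpace X] {D L : ℕ} [NeZero K]
  (lam : ℝ) {xs : X} (hxs : MeasurableSet {xs}) (easy : Generator X K (D + L + 1))
  (v : Fin D → Fin K)

theorem hardGenerator_next_hard (s : Fin L → Fin K) (p : Prefix K (D + L + 1)) :
    (hardGenerator lam hxs easy v s).next xs p =
      hiddenPathNext lam (List.ofFn v ++ List.ofFn s) p := by
  simp [hardGenerator]

theorem hardGenerator_next_easy (s : Fin L → Fin K) {x : X} (hx : x ≠ xs)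
    (p : Prefix K (D + L + 1)) :
    (hardGenerator lam hxs easy v s).next x p = easy.next x p := by
  simp [hardGenerator, hx]

theorem hardGenerator_respProb_easy (s : Fin L → Fin K) {x : X} (hx : x ≠ xs) :
    (hardGenerator lam hxs easy v s).respProb x = easy.respProb x := by
  funext y
  simp only [Generator.respProb, hardGenerator_next_easy lam hxs easy v s hx]

theorem hardGenerator_respProb_pos (s : Fin L → Fin K) (y : Resp K (D + L + 1)) :
    0 < (hardGenerator lam hxs easy v s).respProb xs y := by
  refine Finset.prod_pos fun t _ => ?_
  rw [hardGenerator_next_hard]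
  exact hiddenPathNext_pos _ _ _ _

/-- The target completion has base mass `q₀ = p_+^{D+L} / K`. -/
theorem hardGenerator_respProb_target (τ : Bool → Fin K) (s : Fin L → Fin K) (b : Bool) :
    (hardGenerator lam hxs easy v s).respProb xs (target v τ s b) =
      pPlus K lam ^ (D + L) / K := by
  rw [Generator.respProb, Fin.prod_univ_castSucc, div_eq_mul_one_div]
  congr 1
  · rw [← Fin.prod_const]
    refine Finset.prod_congr rfl fun t _ => ?_
    have hlen : (List.ofFn v ++ List.ofFn s).length = D + L := by simp
    rw [hardGenerator_next_hard, hiddenPathNext_take lam _ _ t ?_ (by rw [hlen]; exact t.2)]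
    · simp [tilted, target, ← List.ofFn_fin_append]
    · simp only [visited, target, Fin.val_castSucc]
      rw [take_ofFn_snoc _ _ t.2.le, ← List.ofFn_fin_append]
  · rw [hardGenerator_next_hard, hiddenPathNext, dif_neg]
    · rfl
    · simp [visited]

/-- The rollouts that follow `v` have base mass `p_+^D`. -/
theorem sum_respProb_extends (s : Fin L → Fin K) [∀ y : Resp K (D + L + 1),
    Decidable (∀ i : Fin D, y (Fin.castAdd (L + 1) i) = v i)] :
    ∑ y : Resp K (D + L + 1), (if ∀ i : Fin D, y (Fin.castAdd (L + 1) i) = v i then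
      (hardGenerator lam hxs easy v s).respProb xs y else 0) = pPlus K lam ^ D := by
  classical
  set M := hardGenerator lam hxs easy v s
  have h := sum_pathProb_castAdd (w := M.weights xs) D (L + 1) (fun l hl => M.sum_weights xs hl)
    fun y => if y = v then 1 else 0
  simp only [mul_ite, mul_one, mul_zero, Finset.sum_ite_eq', Finset.mem_univ, if_true] at h
  have hv : pathProb (M.weights xs) v = pPlus K lam ^ D := by
    rw [pathProb, ← Fin.prod_const]
    refine Finset.prod_congr rfl fun t _ => ?_
    have hlen : (List.ofFn v ++ List.ofFn s).length = D + L := by simp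
    have hlt : ((List.ofFn v).take t).length < D + L + 1 := by
      simp only [List.length_take, List.length_ofFn]; omega
    rw [Generator.weights, dif_pos hlt, hardGenerator_next_hard,
      hiddenPathNext_take lam _ _ t ?_ (by rw [hlen]; omega)]
    · simp [tilted, List.getElem_append_left]
    · simp only [toPrefix]
      rw [List.take_append_of_le_length (by simp)]
  rw [← hv, ← h]
  refine Finset.sum_congr rfl fun y _ => ?_
  simp only [M.respProb_eq, funext_iff]

/-- Rollouts that leave `v` carry no information on the suffix. -/
theorem hardGenerator_next_visited_congr (s s' : Fin L → Fin K) {y : Resp K (D + L + 1)}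
    (hy : ¬ ∀ i : Fin D, y (Fin.castAdd (L + 1) i) = v i) (t : Fin (D + L + 1)) :
    (hardGenerator lam hxs easy v s).next xs (visited y t) =
      (hardGenerator lam hxs easy v s').next xs (visited y t) := by
  rw [hardGenerator_next_hard, hardGenerator_next_hard]
  have hlen : (visited y t).1.length = t := by simp [visited, t.2.le]
  -- Before depth `D` only `v` decides the favored token. From depth `D` on, a string that has left
  -- `v` is no prefix of the path, whatever the suffix.
  rcases lt_or_ge t.1 D with ht | ht
  · by_cases hp : (visited y t).1 = (List.ofFn v).take t
    · have h1 : ∀ s : Fin L → Fin K, (visited y t).1 = (List.ofFn v ++ List.ofFn s).take t := by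
        intro s
        rw [List.take_append_of_le_length (by simpa using ht.le), hp]
      rw [hiddenPathNext_take lam _ _ t (h1 s) (by simp; omega),
        hiddenPathNext_take lam _ _ t (h1 s') (by simp; omega)]
      congr 1
      rw [List.getElem_append_left (by simpa using ht), List.getElem_append_left (by simpa using ht)]
    · have h1 : ∀ s : Fin L → Fin K, ¬ (visited y t).1 <+: List.ofFn v ++ List.ofFn s := by
        intro s h
        apply hp
        rw [List.prefix_iff_eq_take, hlen,
          List.take_append_of_le_length (by simpa using ht.le)] at h
        exact h
      rw [hiddenPathNext, dif_neg fun h => h1 s h.1, hiddenPathNext, dif_neg fun h => h1 s' h.1]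
  · have h1 : ∀ s : Fin L → Fin K, ¬ (visited y t).1 <+: List.ofFn v ++ List.ofFn s := by
      intro s h
      apply hy
      intro i
      rw [List.prefix_iff_eq_take, hlen] at h
      have h2 := congrArg (fun l : List (Fin K) => l[i.1]?) h
      have hit : i.1 < t.1 := i.2.trans_le ht
      simp only [visited, List.getElem?_take_of_lt hit] at h2
      rw [List.getElem?_append_left (by simp), List.getElem?_ofFn, List.getElem?_ofFn,
        dif_pos (by omega), dif_pos i.2] at h2
      exact Option.some.inj h2
    rw [hiddenPathNext, dif_neg fun h => h1 s h.1, hiddenPathNext, dif_neg fun h => h1 s' h.1]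

end HardPrompt

/-! ### The regularized objective on the hard family -/

/-- A negative `c` does no harm, since `c` never exceeds its truncation. The form allows an infinite
KL term `b`. -/
theorem EReal_coe_sub_coe_ennreal_le {a c : ℝ} {b : ℝ≥0∞} (h : ENNReal.ofReal c ≤ b) :
    (a : EReal) - (b : EReal) ≤ ((a - c : ℝ) : EReal) := by
  have h1 : ((c : ℝ) : EReal) ≤ (b : EReal) := by
    refine le_trans ?_ (EReal.coe_ennreal_le_coe_ennreal_iff.2 h)
    rw [EReal.coe_ennreal_ofReal]
    exact EReal.coe_le_coe_iff.2 (le_max_left _ _)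
  rw [EReal.coe_sub]
  exact EReal.sub_le_sub le_rfl h1

/-- The base mass `q₀` of the target. -/
def targetMass (K D L : ℕ) (lam : ℝ) : ℝ := pPlus K lam ^ (D + L) / K

open scoped Classical in
/-- The exponent that raises the mass of the target to `t` before normalization. -/
def tiltAt {K D L : ℕ} (lam : ℝ) (t : ℝ) (z : Resp K (D + L + 1)) (y : Resp K (D + L + 1)) : ℝ :=
  if y = z then Real.log (t / targetMass K D L lam) else 0

theorem sum_mul_tiltAt {K D L : ℕ} (lam t : ℝ) (z : Resp K (D + L + 1)) (w : Resp K (D + L + 1) → ℝ) :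
    ∑ y, w y * tiltAt lam t z y = w z * Real.log (t / targetMass K D L lam) := by
  simp [tiltAt]

section HardObjective

variable {X : Type*} [MeasurableSpace X] {K D L : ℕ} [NeZero K]
  (lam β : ℝ) {xs : X} (hxs : MeasurableSet {xs}) (easy : Generator X K (D + L + 1))
  (v : Fin D → Fin K) (τ : Bool → Fin K) (s : Fin L → Fin K) (b : Bool)

theorem targetMass_pos (K D L : ℕ) [NeZero K] (lam : ℝ) : 0 < targetMass K D L lam :=
  div_pos (pow_pos (pPlus_pos lam) _) (by exact_mod_cast Nat.pos_of_neZero K)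

theorem targetMass_le_one (K D L : ℕ) [NeZero K] (hK : 2 ≤ K) (lam : ℝ) :
    targetMass K D L lam ≤ 1 := by
  have h1 : (1 : ℝ) ≤ K := by exact_mod_cast (by omega : 1 ≤ K)
  exact (div_le_self (pow_nonneg (pPlus_pos lam).le _) h1).trans
    (pow_le_one₀ (pPlus_pos lam).le (pPlus_lt_one hK lam).le)

theorem rewardScale_eq (K D L : ℕ) (lam β : ℝ) :
    rewardScale K D L lam β = β * Real.log (4 / targetMass K D L lam) := rfl

theorem rewardScale_pos (K D L : ℕ) [NeZero K] (hK : 2 ≤ K) (lam : ℝ) {β : ℝ} (hβ : 0 < β) :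
    0 < rewardScale K D L lam β := by
  rw [rewardScale_eq]
  refine mul_pos hβ (Real.log_pos ?_)
  rw [one_lt_div (targetMass_pos K D L lam)]
  linarith [targetMass_le_one K D L hK lam]

theorem sum_respProb_mul_exp_tiltAt {t : ℝ} (ht : 0 < t) :
    ∑ y, (hardGenerator lam hxs easy v s).respProb xs y *
      Real.exp (tiltAt lam t (target v τ s b) y) = 1 - targetMass K D L lam + t := by
  classical
  have hq := targetMass_pos K D L lam
  rw [← (hardGenerator lam hxs easy v s).sum_respProb xs,
    ← Finset.add_sum_erase _ _ (Finset.mem_univ (target v τ s b)),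
    ← Finset.add_sum_erase (f := (hardGenerator lam hxs easy v s).respProb xs) _
      (Finset.mem_univ (target v τ s b)), hardGenerator_respProb_target]
  rw [Finset.sum_congr rfl fun y hy => by
    rw [tiltAt, if_neg (Finset.ne_of_mem_erase hy), Real.exp_zero, mul_one]]
  rw [tiltAt, if_pos rfl, Real.exp_log (by positivity)]
  change targetMass K D L lam * _ + _ = targetMass K D L lam + _ - _ + _
  field_simp
  ring

variable (ρ : Measure X)

theorem integral_hard_reward (π : Policy X K (D + L + 1)) :
    ∫ x, ∑ y, (π.resp x).1 y * (hardInstance lam β hxs easy v τ s b).reward x y ∂ρ =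
      ρ.real {xs} * ((π.resp xs).1 (target v τ s b) * rewardScale K D L lam β) := by
  classical
  have h : (fun x => ∑ y, (π.resp x).1 y * (hardInstance lam β hxs easy v τ s b).reward x y) =
      Set.indicator {xs} fun _ =>
        (π.resp xs).1 (target v τ s b) * rewardScale K D L lam β := by
    funext x
    by_cases hx : x = xs
    · subst hx
      simp [hardInstance]
    · simp [hardInstance, hx]
  rw [h, integral_indicator hxs, setIntegral_const, smul_eq_mul]

/-- No measurability of `f` is required, so it applies directly to the KL divergence as a function
of the prompt. -/
theorem mul_le_lintegral_of_singleton (hxs : MeasurableSet {xs}) (f : X → ℝ≥0∞) :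
    f xs * ρ {xs} ≤ ∫⁻ x, f x ∂ρ := by
  calc f xs * ρ {xs} = ∫⁻ _ in {xs}, f xs ∂ρ := by rw [setLIntegral_const]
    _ = ∫⁻ x in {xs}, f x ∂ρ := setLIntegral_congr_fun hxs fun x hx => by
        rw [Set.mem_singleton_iff.1 hx]
    _ ≤ _ := setLIntegral_le_lintegral _ _

variable [IsProbabilityMeasure ρ]

/-- Each tilt of the target bounds the objective from above. -/
theorem hard_objective_le (hβ : 0 < β) {t : ℝ} (ht : 0 < t) (π : Policy X K (D + L + 1)) :
    (hardInstance lam β hxs easy v τ s b).objective ρ β π ≤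
      ((ρ.real {xs} * β * ((π.resp xs).1 (target v τ s b) * Real.log (4 / t) +
        Real.log (1 - targetMass K D L lam + t)) : ℝ) : EReal) := by
  have hq := targetMass_pos K D L lam
  set p := (π.resp xs).1 (target v τ s b) with hp
  have hη : 0 ≤ ρ.real {xs} := measureReal_nonneg
  have hkl := le_klDiv_massMeasure (π.resp xs) ((hardGenerator lam hxs easy v s).respDist xs)
    (hardGenerator_respProb_pos lam hxs easy v s) (tiltAt lam t (target v τ s b))
  rw [sum_mul_tiltAt] at hkl
  simp only [Generator.respDist] at hkl
  rw [sum_respProb_mul_exp_tiltAt lam hxs easy v τ s b ht, ← hp] at hkl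
  rw [Instance.objective, integral_hard_reward, ← hp, rewardScale_eq]
  -- Only the hard prompt is kept in the averaged KL term; the other prompts contribute nonnegative
  -- amounts.
  have key : ENNReal.ofReal (β * ((p * Real.log (t / targetMass K D L lam) -
      Real.log (1 - targetMass K D L lam + t)) * ρ.real {xs})) ≤
      ENNReal.ofReal β * ∫⁻ x, InformationTheory.klDiv (massMeasure (π.resp x).1)
        (massMeasure ((hardGenerator lam hxs easy v s).respProb x)) ∂ρ := by
    rw [ENNReal.ofReal_mul hβ.le]
    refine mul_le_mul_right ?_ _
    rw [ENNReal.ofReal_mul' hη, ofReal_measureReal]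
    exact (mul_le_mul_left hkl _).trans (mul_le_lintegral_of_singleton ρ hxs
      fun x => InformationTheory.klDiv (massMeasure (π.resp x).1)
        (massMeasure ((hardGenerator lam hxs easy v s).respProb x)))
  refine (EReal_coe_sub_coe_ennreal_le key).trans (EReal.coe_le_coe_iff.2 (le_of_eq ?_))
  rw [Real.log_div ht.ne' hq.ne', Real.log_div four_ne_zero hq.ne',
    Real.log_div four_ne_zero ht.ne']
  ring

open scoped Classical in
/-- The Gibbs policy of the hard instance. -/
def hardOptimizer : Policy X K (D + L + 1) where
  resp x := if x = xs then gibbs ((hardGenerator lam hxs easy v s).respDist xs)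
    (hardGenerator_respProb_pos lam hxs easy v s) (tiltAt lam 4 (target v τ s b))
    else easy.respDist x
  measurable_resp := Measurable.ite hxs measurable_const easy.measurable_respDist

/-- Since `R / β = log (4 / q₀)`, the tilt with `t = 4` is the Gibbs tilt `e^(r/β)`, for which
Donsker–Varadhan is an equality. -/
theorem hardOptimizer_objective_ge (hβ : 0 < β) :
    ((ρ.real {xs} * β * Real.log (5 - targetMass K D L lam) : ℝ) : EReal) ≤
    (hardInstance lam β hxs easy v τ s b).objective ρ β (hardOptimizer lam hxs easy v τ s b) := by
  classical
  have hη : 0 ≤ ρ.real {xs} := measureReal_nonneg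
  set π := hardOptimizer lam hxs easy v τ s b with hπ
  set M := hardGenerator lam hxs easy v s with hM
  set p := (π.resp xs).1 (target v τ s b) with hp
  have hres : π.resp xs = gibbs (M.respDist xs)
      (hardGenerator_respProb_pos lam hxs easy v s) (tiltAt lam 4 (target v τ s b)) := by
    simp [hπ, hardOptimizer, hM]
  have hnn := gibbs_sub_log_nonneg (M.respDist xs)
    (hardGenerator_respProb_pos lam hxs easy v s) (tiltAt lam 4 (target v τ s b))
  have hkl := klDiv_massMeasure_gibbs (M.respDist xs)
    (hardGenerator_respProb_pos lam hxs easy v s) (tiltAt lam 4 (target v τ s b))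
  rw [← hres, sum_mul_tiltAt, ← hp] at hkl hnn
  simp only [Generator.respDist] at hkl hnn
  rw [sum_respProb_mul_exp_tiltAt lam hxs easy v τ s b four_pos,
    show 1 - targetMass K D L lam + 4 = 5 - targetMass K D L lam by ring] at hkl hnn
  -- Away from the hard prompt the policy equals the base generator, so its divergence is zero
  -- there.
  have hfun : (fun x => InformationTheory.klDiv (massMeasure (π.resp x).1)
      (massMeasure (M.respProb x))) = Set.indicator {xs} fun _ =>
      InformationTheory.klDiv (massMeasure (π.resp xs).1) (massMeasure (M.respProb xs)) := by
    funext x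
    by_cases hx : x = xs
    · subst hx
      simp
    · have h1 : (π.resp x).1 = M.respProb x := by
        rw [hM, hardGenerator_respProb_easy lam hxs easy v s hx]
        simp [hπ, hardOptimizer, hx, Generator.respDist]
      have := isProbabilityMeasure_massMeasure (π.resp x)
      rw [← h1]
      simp [hx]
  have hint : ∫⁻ x, InformationTheory.klDiv (massMeasure (π.resp x).1)
      (massMeasure (M.respProb x)) ∂ρ =
      ENNReal.ofReal ((p * Real.log (4 / targetMass K D L lam) -
        Real.log (5 - targetMass K D L lam)) * ρ.real {xs}) := by
    rw [hfun, lintegral_indicator_const hxs, hkl, ENNReal.ofReal_mul' hη, ofReal_measureReal]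
  rw [Instance.objective, integral_hard_reward, ← hp, rewardScale_eq]
  change _ ≤ _ - ((ENNReal.ofReal β * ∫⁻ x, InformationTheory.klDiv (massMeasure (π.resp x).1)
      (massMeasure (M.respProb x)) ∂ρ : ℝ≥0∞) : EReal)
  rw [hint, ← ENNReal.ofReal_mul hβ.le, EReal.coe_ennreal_ofReal,
    max_eq_left (mul_nonneg hβ.le (mul_nonneg hnn hη)), ← EReal.coe_sub]
  refine EReal.coe_le_coe_iff.2 (le_of_eq ?_)
  ring

theorem hard_objective_le_optimum (hβ : 0 < β) (π : Policy X K (D + L + 1)) :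
    (hardInstance lam β hxs easy v τ s b).objective ρ β π ≤
      ((ρ.real {xs} * β * Real.log (5 - targetMass K D L lam) : ℝ) : EReal) := by
  have h := hard_objective_le lam β hxs easy v τ s b ρ hβ four_pos π
  rwa [div_self four_ne_zero, Real.log_one, mul_zero, zero_add,
    show 1 - targetMass K D L lam + 4 = 5 - targetMass K D L lam by ring] at h

theorem hardOptimizer_isOptimizer (hβ : 0 < β) :
    (hardInstance lam β hxs easy v τ s b).IsOptimizer ρ β (hardOptimizer lam hxs easy v τ s b) :=
  fun π => (hard_objective_le_optimum lam β hxs easy v τ s b ρ hβ π).trans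
    (hardOptimizer_objective_ge lam β hxs easy v τ s b ρ hβ)

/-- Small regret forces mass on the target. -/
theorem lt_of_hard_regret_le (hK : 2 ≤ K) (hβ : 0 < β) (hη : 0 < ρ.real {xs})
    (π : Policy X K (D + L + 1))
    (h : (hardInstance lam β hxs easy v τ s b).regret ρ β π ≤
      ((ρ.real {xs} * β / 4 : ℝ) : EReal)) :
    1 / 4 < (π.resp xs).1 (target v τ s b) := by
  by_contra hp
  push Not at hp
  have hq := targetMass_pos K D L lam
  have hq1 := targetMass_le_one K D L hK lam
  -- With `t = 1` and `p ≤ 1/4` the bound is at most `(1/4) log 4 + log 2 = (3/2) log 2`, while the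
  -- optimum is at least `log 4 = 2 log 2`. The gap `(1/2) log 2` exceeds `1/4`.
  have h1 := hard_objective_le lam β hxs easy v τ s b ρ hβ one_pos π
  have h2 : ((ρ.real {xs} * β * Real.log (5 - targetMass K D L lam) : ℝ) : EReal) ≤
      ⨆ π' : Policy X K (D + L + 1),
        (hardInstance lam β hxs easy v τ s b).objective ρ β π' :=
    (hardOptimizer_objective_ge lam β hxs easy v τ s b ρ hβ).trans (le_iSup _ _)
  have h3 := (EReal.sub_le_sub h2 h1).trans h
  rw [← EReal.coe_sub, EReal.coe_le_coe_iff] at h3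
  set p := (π.resp xs).1 (target v τ s b)
  have hl4 : Real.log 4 = 2 * Real.log 2 := by
    rw [show (4 : ℝ) = 2 ^ 2 by norm_num, Real.log_pow]; norm_num
  have hl2 := Real.log_two_gt_d9
  have ha : Real.log 4 ≤ Real.log (5 - targetMass K D L lam) :=
    Real.log_le_log four_pos (by linarith)
  have hb : Real.log (1 - targetMass K D L lam + 1) ≤ Real.log 2 :=
    Real.log_le_log (by linarith) (by linarith)
  have hc : p * Real.log (4 / 1) ≤ 1 / 4 * Real.log (4 / 1) :=
    mul_le_mul_of_nonneg_right hp (Real.log_nonneg (by norm_num))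
  rw [div_one] at hc h3
  have hpos : 0 < ρ.real {xs} * β := mul_pos hη hβ
  have : ρ.real {xs} * β * (1 / 4) <
      ρ.real {xs} * β * (Real.log (5 - targetMass K D L lam) -
        (p * Real.log 4 + Real.log (1 - targetMass K D L lam + 1))) :=
    mul_lt_mul_of_pos_left (by linarith) hpos
  linarith

end HardObjective

/-! ### Oracles as Markov kernels -/

section Markov

variable {X : Type*} [MeasurableSpace X] {K H : ℕ}

theorem lintegral_mixture {B ι : Type*} [MeasurableSpace B] [Fintype ι] (w : ι → ℝ)
    (μ : ι → Measure B) (f : B → ℝ≥0∞) :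
    ∫⁻ x, f x ∂(∑ i, ENNReal.ofReal (w i) • μ i) = ∑ i, ENNReal.ofReal (w i) * ∫⁻ x, f x ∂μ i := by
  simp [lintegral_finsetSum_measure]

theorem isProbabilityMeasure_mixture {B ι : Type*} [MeasurableSpace B] [Fintype ι]
    (w : ProbDist ι) (μ : ι → Measure B) [∀ i, IsProbabilityMeasure (μ i)] :
    IsProbabilityMeasure (∑ i, ENNReal.ofReal (w.1 i) • μ i) := by
  refine ⟨?_⟩
  simp only [Measure.coe_finsetSum, Finset.sum_apply, Measure.smul_apply,
    smul_eq_mul, measure_univ, mul_one]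
  rw [← ENNReal.ofReal_sum_of_nonneg fun a _ => w.2.1 a, w.2.2, ENNReal.ofReal_one]

instance (M : Generator X K H) : IsMarkovKernel (prefixSample M) :=
  ⟨fun q => isProbabilityMeasure_massMeasure (M.next q.1 q.2)⟩

instance {Q Y : Type*} [MeasurableSpace Q] [MeasurableSpace Y]
    (Γ : Kernel (X × Q × Resp K H × (Fin H → ProbDist (Fin K))) Y) [IsMarkovKernel Γ]
    (M : Generator X K H) : IsMarkovKernel (noReset Γ M) :=
  ⟨fun q => isProbabilityMeasure_mixture (M.respDist q.1) _⟩

instance (I : Instance X K H) : IsMarkovKernel (rewardOracle I) :=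
  ⟨fun a => isProbabilityMeasure_mixture a.2 _⟩

variable {GQ GR : Type*} [MeasurableSpace GQ] [MeasurableSpace GR]

theorem replyKernel_inl (G : Kernel GQ GR) (R : Kernel (X × ProbDist (Resp K H)) (Resp K H × ℝ))
    (q : GQ) : replyKernel G R (Sum.inl q) = (G q).map Sum.inl := rfl

theorem replyKernel_reward (G : Kernel GQ GR)
    (R : Kernel (X × ProbDist (Resp K H)) (Resp K H × ℝ)) (a : X × ProbDist (Resp K H)) :
    replyKernel G R (Sum.inr (Sum.inl a)) = (R a).map fun o => Sum.inr (Sum.inl o) := rfl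

theorem replyKernel_unit (G : Kernel GQ GR)
    (R : Kernel (X × ProbDist (Resp K H)) (Resp K H × ℝ)) (a : Unit) :
    replyKernel G R (Sum.inr (Sum.inr a)) = Measure.dirac (Sum.inr (Sum.inr ())) := rfl

theorem measurable_rewardReply :
    Measurable fun o : Resp K H × ℝ => (Sum.inr (Sum.inl o) : Reply GR K H) :=
  measurable_inr.comp measurable_inl

instance (G : Kernel GQ GR) [IsMarkovKernel G]
    (R : Kernel (X × ProbDist (Resp K H)) (Resp K H × ℝ)) [IsMarkovKernel R] :
    IsMarkovKernel (replyKernel G R) := by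
  refine ⟨fun a => ?_⟩
  rcases a with q | a | u
  · rw [replyKernel_inl]
    exact Measure.isProbabilityMeasure_map measurable_inl.aemeasurable
  · rw [replyKernel_reward]
    exact Measure.isProbabilityMeasure_map measurable_rewardReply.aemeasurable
  · rw [replyKernel_unit]
    infer_instance

end Markov

/-! ### Laws of runs -/

namespace Algorithm

variable {Ω X GQ GR : Type*} [MeasurableSpace Ω] [MeasurableSpace X]
  [MeasurableSpace GQ] [MeasurableSpace GR] {K H : ℕ}

theorem measurable_snoc_reply (n : ℕ) :
    Measurable fun p : (Ω × (Fin n → Reply GR K H)) × Reply GR K H =>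
      ((p.1.1, Fin.snoc p.1.2 p.2) : Ω × (Fin (n + 1) → Reply GR K H)) := by
  refine (measurable_fst.comp measurable_fst).prodMk (measurable_pi_lambda _ fun i => ?_)
  induction i using Fin.lastCases with
  | last => simpa using measurable_snd
  | cast i =>
    simp only [Fin.snoc_castSucc]
    exact (measurable_pi_apply i).comp (measurable_snd.comp measurable_fst)

variable (A : Algorithm Ω X GQ GR K H) (G : Kernel GQ GR)
    (R : Kernel (X × ProbDist (Resp K H)) (Resp K H × ℝ))

theorem lintegral_step (n : ℕ) (τ : Ω × (Fin n → Reply GR K H))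
    {f : Ω × (Fin (n + 1) → Reply GR K H) → ℝ≥0∞} (hf : Measurable f) :
    ∫⁻ x, f x ∂((replyKernel G R (A.act n τ)).map fun o => (τ.1, Fin.snoc τ.2 o)) =
      ∫⁻ o, f (τ.1, Fin.snoc τ.2 o) ∂replyKernel G R (A.act n τ) :=
  lintegral_map hf ((measurable_snoc_reply n).comp measurable_prodMk_left)

section

variable [IsMarkovKernel G] [IsMarkovKernel R]

theorem measurable_step (n : ℕ) :
    Measurable fun τ : Ω × (Fin n → Reply GR K H) =>
      (replyKernel G R (A.act n τ)).map fun o =>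
        ((τ.1, Fin.snoc τ.2 o) : Ω × (Fin (n + 1) → Reply GR K H)) := by
  -- The step is written as the image of a product kernel, whose measurability is automatic.
  have h := ((Kernel.id ×ₖ (replyKernel G R).comap (A.act n) (A.measurable_act n)).map
    fun p : (Ω × (Fin n → Reply GR K H)) × Reply GR K H =>
      ((p.1.1, Fin.snoc p.1.2 p.2) : Ω × (Fin (n + 1) → Reply GR K H))).measurable
  convert h using 2 with τ
  rw [Kernel.map_apply _ (measurable_snoc_reply n), Kernel.prod_apply, Kernel.id_apply,
    Kernel.comap_apply, Measure.dirac_prod, Measure.map_map (measurable_snoc_reply n)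
      measurable_prodMk_left]
  rfl

theorem measurable_lintegral_step (n : ℕ) {f : Ω × (Fin (n + 1) → Reply GR K H) → ℝ≥0∞}
    (hf : Measurable f) : Measurable fun τ : Ω × (Fin n → Reply GR K H) =>
      ∫⁻ o, f (τ.1, Fin.snoc τ.2 o) ∂replyKernel G R (A.act n τ) := by
  simp only [← A.lintegral_step G R n _ hf]
  exact (Measure.measurable_lintegral hf).comp (A.measurable_step G R n)

theorem lintegral_lawUpTo_succ (n : ℕ) {f : Ω × (Fin (n + 1) → Reply GR K H) → ℝ≥0∞}
    (hf : Measurable f) : ∫⁻ x, f x ∂A.lawUpTo G R (n + 1) =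
      ∫⁻ τ, ∫⁻ o, f (τ.1, Fin.snoc τ.2 o) ∂replyKernel G R (A.act n τ) ∂A.lawUpTo G R n := by
  rw [lawUpTo, Measure.lintegral_bind (A.measurable_step G R n).aemeasurable hf.aemeasurable]
  simp only [A.lintegral_step G R n _ hf]

instance isProbabilityMeasure_lawUpTo (n : ℕ) : IsProbabilityMeasure (A.lawUpTo G R n) := by
  induction n with
  | zero =>
    have := A.isProbabilityMeasure_seedLaw
    exact Measure.isProbabilityMeasure_map
      (measurable_id.prodMk measurable_const).aemeasurable
  | succ n ih =>
    refine ⟨?_⟩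
    have h := A.lintegral_lawUpTo_succ G R n (f := fun _ => 1) measurable_const
    simpa using h

/-- A nonnegative process that does not increase in conditional mean does not increase in mean. -/
theorem lintegral_lawUpTo_le (V : (n : ℕ) → (Ω × (Fin n → Reply GR K H)) → ℝ≥0∞)
    (hV : ∀ n, Measurable (V n)) (N : ℕ)
    (hstep : ∀ n < N, ∀ τ, ∫⁻ o, V (n + 1) (τ.1, Fin.snoc τ.2 o) ∂replyKernel G R (A.act n τ) ≤
      V n τ) : ∫⁻ τ, V N τ ∂A.lawUpTo G R N ≤ ∫⁻ τ, V 0 τ ∂A.lawUpTo G R 0 := by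
  induction N with
  | zero => exact le_rfl
  | succ N ih =>
    rw [A.lintegral_lawUpTo_succ G R N (hV _)]
    exact (lintegral_mono fun τ => hstep N (Nat.lt_succ_self N) τ).trans
      (ih fun n hn => hstep n (hn.trans (Nat.lt_succ_self N)))

/-- Two pairs of oracles whose replies to the action `a` differ by at most `ε a` in total variation
produce runs that differ by at most the expected sum of `ε` along the second run. -/
theorem lintegral_lawUpTo_le_add (G' : Kernel GQ GR) [IsMarkovKernel G']
    (R' : Kernel (X × ProbDist (Resp K H)) (Resp K H × ℝ)) [IsMarkovKernel R']
    (ε : Action X GQ K H → ℝ≥0∞)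
    (hε : ∀ a (g : Reply GR K H → ℝ≥0∞), Measurable g → (∀ o, g o ≤ 1) →
      ∫⁻ o, g o ∂replyKernel G R a ≤ ∫⁻ o, g o ∂replyKernel G' R' a + ε a)
    (n : ℕ) (f : Ω × (Fin n → Reply GR K H) → ℝ≥0∞) (hf : Measurable f) (hf1 : ∀ τ, f τ ≤ 1) :
    ∫⁻ τ, f τ ∂A.lawUpTo G R n ≤ ∫⁻ τ, f τ ∂A.lawUpTo G' R' n +
      ∑ m ∈ Finset.range n, ∫⁻ τ, ε (A.act m τ) ∂A.lawUpTo G' R' m := by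
  induction n with
  | zero => simp [lawUpTo]
  | succ n ih =>
    rw [A.lintegral_lawUpTo_succ G R n hf, A.lintegral_lawUpTo_succ G' R' n hf]
    -- Hybrid argument: the first `n` replies are exchanged while the last is still averaged under
    -- `G`, `R`; then the last one is exchanged along the second run.
    refine (ih _ (A.measurable_lintegral_step G R n hf) fun τ => ?_).trans ?_
    · exact (lintegral_mono fun o => hf1 _).trans (by simp)
    · rw [Finset.sum_range_succ, add_comm (Finset.sum _ _), ← add_assoc]
      gcongr
      rw [← lintegral_add_left (A.measurable_lintegral_step G' R' n hf)]
      exact lintegral_mono fun τ => hε _ _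
        (hf.comp ((measurable_snoc_reply n).comp measurable_prodMk_left)) fun o => hf1 _

theorem measurable_act_castLE {n m : ℕ} (hm : m ≤ n) :
    Measurable fun τ : Ω × (Fin n → Reply GR K H) =>
      A.act m (τ.1, fun i => τ.2 (Fin.castLE hm i)) :=
  (A.measurable_act m).comp (measurable_fst.prodMk
    (measurable_pi_lambda _ fun _ => (measurable_pi_apply _).comp measurable_snd))

theorem measurable_sum_act {h : Action X GQ K H → ℝ≥0∞} (hh : Measurable h) (n : ℕ) :
    Measurable fun τ : Ω × (Fin n → Reply GR K H) =>
      ∑ m : Fin n, h (A.act m (τ.1, fun i => τ.2 (Fin.castLE m.2.le i))) :=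
  Finset.measurable_sum _ fun m _ => hh.comp (A.measurable_act_castLE m.2.le)

/-- Collects the expected costs of the rounds into one expectation over whole runs, where the
pathwise query budget applies. -/
theorem sum_lintegral_act {h : Action X GQ K H → ℝ≥0∞} (hh : Measurable h) (n : ℕ) :
    ∑ m ∈ Finset.range n, ∫⁻ τ, h (A.act m τ) ∂A.lawUpTo G R m =
      ∫⁻ τ, ∑ m : Fin n, h (A.act m (τ.1, fun i => τ.2 (Fin.castLE m.2.le i)))
        ∂A.lawUpTo G R n := by
  induction n with
  | zero => simp
  | succ n ih =>
    rw [Finset.sum_range_succ, ih, A.lintegral_lawUpTo_succ G R n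
      (A.measurable_sum_act hh (n + 1)), ← lintegral_add_left (A.measurable_sum_act hh n)]
    refine lintegral_congr fun τ => ?_
    have h1 : ∀ o : Reply GR K H, ∑ m : Fin (n + 1), h (A.act m (τ.1, fun i =>
        (Fin.snoc τ.2 o : Fin (n + 1) → Reply GR K H) (Fin.castLE m.2.le i))) =
        ∑ m : Fin n, h (A.act m (τ.1, fun i => τ.2 (Fin.castLE m.2.le i))) + h (A.act n τ) := by
      intro o
      rw [Fin.sum_univ_castSucc]
      congr 1
      · refine Finset.sum_congr rfl fun m _ => ?_
        congr 3
        funext i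
        exact Fin.snoc_castSucc (α := fun _ => Reply GR K H) o τ.2 (Fin.castLE m.2.le i)
      · congr 2
        refine Prod.ext rfl (funext fun i => ?_)
        exact Fin.snoc_castSucc (α := fun _ => Reply GR K H) o τ.2 i
    simp only [h1, lintegral_const, measure_univ, mul_one]

end

end Algorithm

/-! ### No-reset access -/

theorem measurable_prob_apply {α : Type*} [Fintype α] (a : α) :
    Measurable fun w : ProbDist α => w.1 a :=
  (measurable_pi_apply a).comp measurable_subtype_coe

theorem target_injective {K D L : ℕ} (v : Fin D → Fin K) (τ : Bool → Fin K) (b : Bool) :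
    Function.Injective fun s : Fin L → Fin K => target v τ s b := by
  intro s s' h
  funext i
  have h1 := congrFun h (Fin.castSucc (Fin.natAdd D i))
  simpa only [target, Fin.snoc_castSucc, Fin.append_right] using h1

theorem sum_target_le_one {K D L : ℕ} (v : Fin D → Fin K) (τ : Bool → Fin K)
    (w : ProbDist (Resp K (D + L + 1))) (b : Bool) :
    ∑ s : Fin L → Fin K, ENNReal.ofReal (w.1 (target v τ s b)) ≤ 1 := by
  classical
  rw [← ENNReal.ofReal_sum_of_nonneg fun s _ => w.2.1 _, ← ENNReal.ofReal_one]
  refine ENNReal.ofReal_le_ofReal ?_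
  rw [← w.2.2, ← Finset.sum_image (f := w.1) fun s _ s' _ h => target_injective v τ b h]
  exact Finset.sum_le_univ_sum_of_nonneg w.2.1

/-! ### Information revealed by one query -/

section Leakage

variable {X Q : Type*} {K D L : ℕ} (lam : ℝ) (v : Fin D → Fin K) (τ : Bool → Fin K)

open scoped Classical in
/-- How much the reply to an action can reveal about the instance with suffix `s`. -/
def leakage (xs : X) (s : Fin L → Fin K) : Action X (X × Q) K (D + L + 1) → ℝ≥0∞ :=
  Sum.elim (fun _ => ENNReal.ofReal (pPlus K lam ^ D))
    (Sum.elim (fun a => if a.1 = xs then ENNReal.ofReal (a.2.1 (target v τ s false)) else 0)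
      fun _ => 0)

/-- Cost of an action, summed over the suffixes. -/
def totalLeakage (K D L : ℕ) (lam : ℝ) : Action X (X × Q) K (D + L + 1) → ℝ≥0∞ :=
  Sum.elim (fun _ => (K : ℝ≥0∞) ^ L * ENNReal.ofReal (pPlus K lam ^ D))
    (Sum.elim (fun _ => 1) fun _ => 0)

/-- A generator query may inform about all `K ^ L` suffixes at once, but a reward query divides mass
at most 1 among distinct targets. -/
theorem sum_leakage_le (xs : X) (a : Action X (X × Q) K (D + L + 1)) :
    ∑ s : Fin L → Fin K, leakage lam v τ xs s a ≤ totalLeakage K D L lam a := by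
  rcases a with q | ⟨x, w⟩ | u
  · simp [leakage, totalLeakage]
  · by_cases hx : x = xs
    · simpa [leakage, totalLeakage, hx] using sum_target_le_one v τ w false
    · simp [leakage, totalLeakage, hx]
  · simp [leakage, totalLeakage]

variable [MeasurableSpace X] [MeasurableSpace Q]

theorem measurable_leakage {xs : X} (hxs : MeasurableSet {xs}) (s : Fin L → Fin K) :
    Measurable (leakage (Q := Q) lam v τ xs s) := by
  classical
  refine Measurable.sumElim measurable_const (Measurable.sumElim ?_ measurable_const)
  exact Measurable.ite (measurable_fst hxs)
    ((measurable_prob_apply _).comp measurable_snd).ennreal_ofReal measurable_const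

theorem sum_totalLeakage_le {Y Ω : Type*} [MeasurableSpace Y] [MeasurableSpace Ω]
    (A : Algorithm Ω X (X × Q) Y K (D + L + 1)) {qg qr : ℕ}
    (hA : A.UsesAtMost qg qr) (run : Ω × (Fin A.rounds → Reply Y K (D + L + 1))) :
    ∑ m : Fin A.rounds, totalLeakage K D L lam (A.actionAt run m) ≤
      qg * ((K : ℝ≥0∞) ^ L * ENNReal.ofReal (pPlus K lam ^ D)) + qr := by
  classical
  have hgen : ∀ m, totalLeakage K D L lam (A.actionAt run m) =
      (if ∃ q, A.actionAt run m = Sum.inl q then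
        (K : ℝ≥0∞) ^ L * ENNReal.ofReal (pPlus K lam ^ D) else 0) +
      (if ∃ a, A.actionAt run m = Sum.inr (Sum.inl a) then 1 else 0) := by
    intro m
    rcases A.actionAt run m with q | a | u <;> simp [totalLeakage]
  obtain ⟨h1, h2⟩ := hA run
  rw [Algorithm.genCount, Nat.card_eq_fintype_card, Fintype.card_subtype] at h1
  rw [Algorithm.rewardCount, Nat.card_eq_fintype_card, Fintype.card_subtype] at h2
  simp only [hgen, Finset.sum_add_distrib, ← Finset.sum_filter, Finset.sum_const, nsmul_eq_mul,
    mul_one]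
  gcongr

end Leakage

/-! ### The query lower bound without resets -/

section NoReset

variable {X : Type*} [MeasurableSpace X] {K D L : ℕ} [NeZero K]
  (lam β : ℝ) {xs : X} (hxs : MeasurableSet {xs}) (easy : Generator X K (D + L + 1))
  (v : Fin D → Fin K) (τ : Bool → Fin K)

/-- A base generator with the zero reward. -/
def zeroRewardInstance {H : ℕ} (M : Generator X K H) : Instance X K H where
  base := M
  reward _ _ := 0
  measurable_reward _ := measurable_const
  bounded_reward := ⟨0, by simp⟩

variable {Q Y : Type*} [MeasurableSpace Q] [MeasurableSpace Y]
  (Γ : Kernel (X × Q × Resp K (D + L + 1) × (Fin (D + L + 1) → ProbDist (Fin K))) Y)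

/-- Rollouts that leave `v` have the same mass and the same reply law under both suffixes; the
others have total mass `p_+ ^ D` and a test value at most 1. -/
theorem lintegral_noReset_le [IsMarkovKernel Γ] (s s' : Fin L → Fin K) (q : X × Q)
    {g : Y → ℝ≥0∞} (hg : ∀ o, g o ≤ 1) :
    ∫⁻ o, g o ∂noReset Γ (hardGenerator lam hxs easy v s) q ≤
      ∫⁻ o, g o ∂noReset Γ (hardGenerator lam hxs easy v s') q +
        ENNReal.ofReal (pPlus K lam ^ D) := by
  classical
  obtain ⟨x, q⟩ := q
  set M := hardGenerator lam hxs easy v s with hM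
  set M' := hardGenerator lam hxs easy v s' with hM'
  change ∫⁻ o, g o ∂(∑ y : Resp K (D + L + 1), ENNReal.ofReal (M.respProb x y) •
    Γ (x, q, y, fun t => M.next x (visited y t))) ≤
    ∫⁻ o, g o ∂(∑ y : Resp K (D + L + 1), ENNReal.ofReal (M'.respProb x y) •
    Γ (x, q, y, fun t => M'.next x (visited y t))) + _
  rw [lintegral_mixture, lintegral_mixture]
  by_cases hx : x = xs
  · subst hx
    rw [← sum_respProb_extends lam hxs easy v s, ENNReal.ofReal_sum_of_nonneg
      (fun y _ => by split_ifs; exacts [M.respProb_nonneg x y, le_rfl]), ← Finset.sum_add_distrib]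
    refine Finset.sum_le_sum fun y _ => ?_
    split_ifs with hy
    · refine le_add_left ?_
      refine mul_le_of_le_one_right' ?_
      exact (lintegral_mono hg).trans (by simp)
    · have h1 : ∀ t, M.next x (visited y t) = M'.next x (visited y t) :=
        hardGenerator_next_visited_congr lam hxs easy v s s' hy
      have h2 : M.respProb x y = M'.respProb x y := by
        simp only [Generator.respProb, h1]
      simp only [h1, h2]
      exact le_add_right le_rfl
  · have h1 : ∀ p, M.next x p = M'.next x p := fun p => by
      rw [hM, hM', hardGenerator_next_easy _ _ _ _ _ hx, hardGenerator_next_easy _ _ _ _ _ hx]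
    simp only [Generator.respProb, h1]
    exact le_add_right le_rfl

/-- A reward reply differs from that of the zero reward only when the sampled completion is the
target at the hard prompt. -/
theorem lintegral_reply_le_leakage [IsMarkovKernel Γ] (s s' : Fin L → Fin K)
    (a : Action X (X × Q) K (D + L + 1)) {g : Reply Y K (D + L + 1) → ℝ≥0∞} (hg : Measurable g)
    (hg1 : ∀ o, g o ≤ 1) :
    ∫⁻ o, g o ∂replyKernel (noReset Γ (hardGenerator lam hxs easy v s))
        (rewardOracle (hardInstance lam β hxs easy v τ s false)) a ≤
      ∫⁻ o, g o ∂replyKernel (noReset Γ (hardGenerator lam hxs easy v s'))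
        (rewardOracle (zeroRewardInstance (hardGenerator lam hxs easy v s'))) a +
      leakage lam v τ xs s a := by
  classical
  rcases a with q | ⟨x, w⟩ | u
  · rw [replyKernel_inl, replyKernel_inl, lintegral_map hg measurable_inl,
      lintegral_map hg measurable_inl]
    exact lintegral_noReset_le lam hxs easy v Γ s s' q fun o => hg1 _
  · rw [replyKernel_reward, replyKernel_reward, lintegral_map hg measurable_rewardReply,
      lintegral_map hg measurable_rewardReply]
    change ∫⁻ o, g (Sum.inr (Sum.inl o)) ∂(∑ y : Resp K (D + L + 1), ENNReal.ofReal (w.1 y) •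
      Measure.dirac (y, (hardInstance lam β hxs easy v τ s false).reward x y)) ≤
      ∫⁻ o, g (Sum.inr (Sum.inl o)) ∂(∑ y : Resp K (D + L + 1), ENNReal.ofReal (w.1 y) •
      Measure.dirac (y, (0 : ℝ))) +
      if x = xs then ENNReal.ofReal (w.1 (target v τ s false)) else 0
    have hg' : Measurable fun o : Resp K (D + L + 1) × ℝ => g (Sum.inr (Sum.inl o)) :=
      hg.comp measurable_rewardReply
    rw [lintegral_mixture, lintegral_mixture]
    simp only [lintegral_dirac' _ hg']
    have hrhs : (if x = xs then ENNReal.ofReal (w.1 (target v τ s false)) else 0) =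
        ∑ y, if x = xs ∧ y = target v τ s false then ENNReal.ofReal (w.1 y) else 0 := by
      by_cases hx : x = xs <;> simp [hx]
    rw [hrhs, ← Finset.sum_add_distrib]
    refine Finset.sum_le_sum fun y _ => ?_
    by_cases hy : x = xs ∧ y = target v τ s false
    · rw [if_pos hy]
      exact le_add_left (mul_le_of_le_one_right' (hg1 _))
    · simp [hardInstance, hy]
  · rw [replyKernel_unit, replyKernel_unit]
    exact le_add_right le_rfl

variable {Ω : Type*} [MeasurableSpace Ω]

/-- Success on all suffixes, under no-reset access, needs many queries. -/
theorem two_thirds_mul_le_of_noReset (hK : 2 ≤ K) (hβ : 0 < β) (ρ : Measure X)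
    [IsProbabilityMeasure ρ] (hη : 0 < ρ.real {xs}) [IsMarkovKernel Γ]
    (A : Algorithm Ω X (X × Q) Y K (D + L + 1)) {qg qr : ℕ} (hA : A.UsesAtMost qg qr)
    (hs : ∀ s : Fin L → Fin K,
      2 / 3 ≤ (A.law (noReset Γ (hardGenerator lam hxs easy v s))
        (rewardOracle (hardInstance lam β hxs easy v τ s false))).real
        {run | (hardInstance lam β hxs easy v τ s false).regret ρ β (A.policy run) ≤
          ((ρ.real {xs} * β / 4 : ℝ) : EReal)}) :
    (K : ℝ) ^ L * (2 / 3) ≤ 4 + (qg * ((K : ℝ) ^ L * pPlus K lam ^ D) + qr) := by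
  classical
  -- An arbitrary suffix for the reference run, whose law must not depend on `s`.
  set s₀ : Fin L → Fin K := fun _ => 0
  set G' := noReset Γ (hardGenerator lam hxs easy v s₀) with hG'
  set R' := rewardOracle (zeroRewardInstance (hardGenerator lam hxs easy v s₀)) with hR'
  -- A `[0, 1]`-valued substitute for success: it equals 1 when the target mass exceeds `1/4`, and
  -- its sum over the suffixes is at most 4.
  set f : (Fin L → Fin K) → (Ω × (Fin A.rounds → Reply Y K (D + L + 1))) → ℝ≥0∞ :=
    fun s run => min 1 (4 * ENNReal.ofReal ((A.output (run, xs)).1 (target v τ s false))) with hf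
  have hfm4 : ∀ s, Measurable fun run : Ω × (Fin A.rounds → Reply Y K (D + L + 1)) =>
      4 * ENNReal.ofReal ((A.output (run, xs)).1 (target v τ s false)) := fun s =>
    (((measurable_prob_apply (target v τ s false)).comp
      (A.measurable_output.comp measurable_prodMk_right)).ennreal_ofReal).const_mul 4
  have hfm : ∀ s, Measurable (f s) := fun s => measurable_const.min (hfm4 s)
  have hsucc : ∀ s, ENNReal.ofReal (2 / 3) ≤
      ∫⁻ run, f s run ∂A.law (noReset Γ (hardGenerator lam hxs easy v s))
        (rewardOracle (hardInstance lam β hxs easy v τ s false)) := by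
    intro s
    refine (ENNReal.ofReal_le_of_le_toReal (hs s)).trans ?_
    have h1 := mul_meas_ge_le_lintegral (μ := A.law (noReset Γ (hardGenerator lam hxs easy v s))
      (rewardOracle (hardInstance lam β hxs easy v τ s false))) (hfm s) 1
    rw [one_mul] at h1
    refine le_trans (measure_mono fun run hrun => ?_) h1
    have h2 := lt_of_hard_regret_le lam β hxs easy v τ s false ρ hK hβ hη (A.policy run) hrun
    change (1 : ℝ≥0∞) ≤ f s run
    refine le_min le_rfl ?_
    change 1 / 4 < (A.output (run, xs)).1 (target v τ s false) at h2
    rw [show (4 : ℝ≥0∞) = ENNReal.ofReal 4 by norm_num, ← ENNReal.ofReal_mul four_pos.le,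
      ← ENNReal.ofReal_one]
    exact ENNReal.ofReal_le_ofReal (by linarith)
  have hcomp : ∀ s, ENNReal.ofReal (2 / 3) ≤ ∫⁻ run, f s run ∂A.lawUpTo G' R' A.rounds +
      ∑ m ∈ Finset.range A.rounds, ∫⁻ run, leakage lam v τ xs s (A.act m run)
        ∂A.lawUpTo G' R' m := fun s =>
    (hsucc s).trans (A.lintegral_lawUpTo_le_add _ _ G' R' (leakage lam v τ xs s)
      (fun a g hg hg1 => lintegral_reply_le_leakage lam β hxs easy v τ Γ s s₀ a hg hg1)
      A.rounds (f s) (hfm s) fun run => min_le_left _ _)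
  have hsum := Finset.sum_le_sum fun s (_ : s ∈ Finset.univ) => hcomp s
  rw [Finset.sum_const, Finset.card_univ, Fintype.card_fun, Fintype.card_fin, Fintype.card_fin,
    nsmul_eq_mul, Finset.sum_add_distrib] at hsum
  have hpart1 : ∑ s, ∫⁻ run, f s run ∂A.lawUpTo G' R' A.rounds ≤ 4 := by
    rw [← lintegral_finsetSum _ fun s _ => hfm s]
    calc ∫⁻ run, ∑ s, f s run ∂A.lawUpTo G' R' A.rounds
        ≤ ∫⁻ _, 4 ∂A.lawUpTo G' R' A.rounds := by
          refine lintegral_mono fun run => ?_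
          refine (Finset.sum_le_sum fun s _ => min_le_right _ _).trans ?_
          rw [← Finset.mul_sum]
          exact mul_le_of_le_one_right' (sum_target_le_one v τ _ false)
      _ = 4 := by simp
  have hpart2 : ∑ s, ∑ m ∈ Finset.range A.rounds, ∫⁻ run, leakage lam v τ xs s (A.act m run)
      ∂A.lawUpTo G' R' m ≤ qg * ((K : ℝ≥0∞) ^ L * ENNReal.ofReal (pPlus K lam ^ D)) + qr := by
    have htot : Measurable (totalLeakage (X := X) (Q := Q) K D L lam) :=
      Measurable.sumElim measurable_const (Measurable.sumElim measurable_const measurable_const)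
    rw [Finset.sum_comm]
    calc _ ≤ ∑ m ∈ Finset.range A.rounds, ∫⁻ run, totalLeakage K D L lam (A.act m run)
          ∂A.lawUpTo G' R' m := by
          refine Finset.sum_le_sum fun m _ => ?_
          refine (lintegral_finsetSum _ fun s _ =>
            (measurable_leakage lam v τ hxs s).comp (A.measurable_act m)).symm.trans_le ?_
          exact lintegral_mono fun run => sum_leakage_le lam v τ xs _
      _ = ∫⁻ run, ∑ m : Fin A.rounds, totalLeakage K D L lam (A.actionAt run m)
          ∂A.lawUpTo G' R' A.rounds := A.sum_lintegral_act G' R' htot A.rounds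
      _ ≤ ∫⁻ _, (qg * ((K : ℝ≥0∞) ^ L * ENNReal.ofReal (pPlus K lam ^ D)) + qr)
          ∂A.lawUpTo G' R' A.rounds :=
          lintegral_mono fun run => sum_totalLeakage_le lam A hA run
      _ = _ := by simp
  have hfin := hsum.trans (add_le_add hpart1 hpart2)
  have hpp : 0 ≤ pPlus K lam ^ D := (pow_pos (pPlus_pos lam) D).le
  have hr := ENNReal.toReal_mono (by
    refine ENNReal.add_ne_top.2 ⟨by norm_num, ENNReal.add_ne_top.2
      ⟨ENNReal.mul_ne_top (by simp) (ENNReal.mul_ne_top (by simp) (by simp)), by simp⟩⟩) hfin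
  rw [ENNReal.toReal_add (by norm_num) (ENNReal.add_ne_top.2
      ⟨ENNReal.mul_ne_top (by simp) (ENNReal.mul_ne_top (by simp) (by simp)), by simp⟩),
    ENNReal.toReal_add (ENNReal.mul_ne_top (by simp) (ENNReal.mul_ne_top (by simp) (by simp)))
      (by simp)] at hr
  simpa [ENNReal.toReal_ofReal hpp,
    ENNReal.toReal_ofReal (show (0 : ℝ) ≤ 2 / 3 by norm_num)] using hr

end NoReset

/-! ### Learning the hidden path by repeated local resets -/

/-! ### The Bhattacharyya coefficient of two tilted distributions -/

section VoteWeight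

variable {K : ℕ}

/-- The log-likelihood-type weight that compares `a` with the favored token `c`. -/
def voteWeight (lam : ℝ) (c a b : Fin K) : ℝ :=
  Real.exp (lam / 2 * ((if b = a then 1 else 0) - if b = c then 1 else 0))

theorem voteWeight_pos (lam : ℝ) (c a b : Fin K) : 0 < voteWeight lam c a b := Real.exp_pos _

/-- The Bhattacharyya coefficient that controls a wrong plurality vote. -/
def voteRate (K : ℕ) (lam : ℝ) : ℝ :=
  (2 * Real.exp (lam / 2) + K - 2) / (Real.exp lam + K - 1)

theorem voteRate_pos (hK : 2 ≤ K) (lam : ℝ) : 0 < voteRate K lam := by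
  have h2 : (2 : ℝ) ≤ K := by exact_mod_cast hK
  have h1 := Real.exp_pos lam
  have h3 := Real.exp_pos (lam / 2)
  exact div_pos (by linarith) (by linarith)

/-- Denominator minus numerator is `(e^(λ/2) - 1)^2`. -/
theorem voteRate_lt_one (hK : 2 ≤ K) {lam : ℝ} (hlam : 0 < lam) : voteRate K lam < 1 := by
  have h2 : (2 : ℝ) ≤ K := by exact_mod_cast hK
  have h1 := Real.exp_pos lam
  have h3 : 1 < Real.exp (lam / 2) := Real.one_lt_exp_iff.2 (by linarith)
  have h4 : Real.exp lam = Real.exp (lam / 2) ^ 2 := by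
    rw [← Real.exp_nat_mul]; congr 1; push_cast; ring
  rw [voteRate, div_lt_one (by linarith), h4]
  nlinarith

/-- As `p_+ / p_- = e^λ`, the weight is the square root of the likelihood ratio of `tilted lam a` to
`tilted lam c`, so its mean is `2 √(p_+ p_-) + (K - 2) p_-`. -/
theorem sum_tilted_mul_voteWeight (lam : ℝ) {c a : Fin K} (h : a ≠ c) :
    ∑ b, (tilted lam c).1 b * voteWeight lam c a b = voteRate K lam := by
  have hd := denom_pos c lam
  have hsummand : ∀ b, (tilted lam c).1 b * voteWeight lam c a b = pMinus K lam +
      ((if b = c then pPlus K lam * Real.exp (-(lam / 2)) - pMinus K lam else 0) +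
      if b = a then pMinus K lam * Real.exp (lam / 2) - pMinus K lam else 0) := by
    intro b
    by_cases hbc : b = c
    · subst hbc
      simp [tilted, voteWeight, h.symm]
    · by_cases hba : b = a
      · subst hba
        simp [tilted, voteWeight, hbc]
      · simp [tilted, voteWeight, hbc, hba]
  have hexp : Real.exp lam * Real.exp (-(lam / 2)) = Real.exp (lam / 2) := by
    rw [← Real.exp_add]; congr 1; ring
  simp only [hsummand, Finset.sum_add_distrib, Finset.sum_const, Finset.card_univ,
    Fintype.card_fin, nsmul_eq_mul, Finset.sum_ite_eq', Finset.mem_univ, if_true]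
  rw [pPlus, pMinus, voteRate, div_mul_eq_mul_div, hexp]
  field_simp
  ring

end VoteWeight

/-! ### Plurality votes on blocks of tokens -/

section Tokens

variable {K : ℕ} [NeZero K]

/-- A finite token string as a sequence. -/
def extendTokens {n : ℕ} (y : Fin n → Fin K) (i : ℕ) : Fin K :=
  if h : i < n then y ⟨i, h⟩ else 0

/-- The token in a reply to a generator query. -/
def replyToken {H : ℕ} : Reply (Fin K) K H → Fin K := Sum.elim id fun _ => 0

theorem measurable_replyToken {H : ℕ} : Measurable (replyToken (K := K) (H := H)) :=
  Measurable.sumElim measurable_id measurable_const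

/-- The sequence of tokens in a transcript. -/
def tokens {H n : ℕ} (r : Fin n → Reply (Fin K) K H) : ℕ → Fin K :=
  extendTokens fun i => replyToken (r i)

/-- The tokens factor through the finite discrete space `Fin n → Fin K`, so any function of them is
measurable. -/
theorem measurable_comp_tokens {Ω β : Type*} [MeasurableSpace Ω] [MeasurableSpace β] {H n : ℕ}
    (F : (ℕ → Fin K) → β) :
    Measurable fun τ : Ω × (Fin n → Reply (Fin K) K H) => F (tokens τ.2) := by
  have h : Measurable fun y : Fin n → Fin K => F (extendTokens y) := Measurable.of_discrete
  exact h.comp (measurable_pi_lambda _ fun i =>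
    measurable_replyToken.comp ((measurable_pi_apply i).comp measurable_snd))

theorem tokens_snoc_of_lt {H n : ℕ} (r : Fin n → Reply (Fin K) K H) (o : Reply (Fin K) K H)
    {i : ℕ} (hi : i < n) :
    tokens (Fin.snoc r o : Fin (n + 1) → Reply (Fin K) K H) i = tokens r i := by
  rw [tokens, tokens, extendTokens, extendTokens, dif_pos (hi.trans n.lt_succ_self), dif_pos hi]
  congr 1
  exact Fin.snoc_castSucc (α := fun _ => Reply (Fin K) K H) o r ⟨i, hi⟩

theorem tokens_snoc_self {H n : ℕ} (r : Fin n → Reply (Fin K) K H) (o : Reply (Fin K) K H) :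
    tokens (Fin.snoc r o : Fin (n + 1) → Reply (Fin K) K H) n = replyToken o := by
  rw [tokens, extendTokens, dif_pos n.lt_succ_self]
  congr 1
  exact Fin.snoc_last (α := fun _ => Reply (Fin K) K H) o r

theorem tokens_castLE {H n m : ℕ} (r : Fin n → Reply (Fin K) K H) (hm : m ≤ n) {i : ℕ}
    (hi : i < m) : tokens (fun j : Fin m => r (Fin.castLE hm j)) i = tokens r i := by
  rw [tokens, tokens, extendTokens, extendTokens, dif_pos hi, dif_pos (hi.trans_le hm)]
  rfl

/-- The number of occurrences of `a` in the block `d` of length `N`. -/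
def blockCount (x : ℕ → Fin K) (N d : ℕ) (a : Fin K) : ℕ :=
  ((Finset.Ico (d * N) ((d + 1) * N)).filter fun i => x i = a).card

/-- A token that maximizes the score `c`. -/
def argmaxToken (c : Fin K → ℕ) : Fin K :=
  (Finset.exists_max_image Finset.univ c ⟨0, Finset.mem_univ _⟩).choose

theorem le_argmaxToken (c : Fin K → ℕ) (a : Fin K) : c a ≤ c (argmaxToken c) :=
  (Finset.exists_max_image Finset.univ c ⟨0, Finset.mem_univ _⟩).choose_spec.2 a (Finset.mem_univ a)

/-- A most frequent token of the block `d`. -/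
def plurality (x : ℕ → Fin K) (N d : ℕ) : Fin K := argmaxToken (blockCount x N d)

/-- The first `d` plurality votes. -/
def estPrefix (x : ℕ → Fin K) (N d : ℕ) : List (Fin K) := (List.range d).map (plurality x N)

theorem length_estPrefix (x : ℕ → Fin K) (N d : ℕ) : (estPrefix x N d).length = d := by
  simp [estPrefix]

theorem estPrefix_succ (x : ℕ → Fin K) (N d : ℕ) :
    estPrefix x N (d + 1) = estPrefix x N d ++ [plurality x N d] := by
  simp [estPrefix, List.range_succ]

theorem plurality_congr {x x' : ℕ → Fin K} {N d : ℕ} (h : ∀ i < (d + 1) * N, x i = x' i) :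
    plurality x N d = plurality x' N d := by
  rw [plurality, plurality]
  congr 1
  funext a
  rw [blockCount, blockCount]
  congr 1
  refine Finset.filter_congr fun i hi => ?_
  rw [h i (Finset.mem_Ico.1 hi).2]

theorem estPrefix_congr {x x' : ℕ → Fin K} {N d : ℕ} (h : ∀ i < d * N, x i = x' i) :
    estPrefix x N d = estPrefix x' N d := by
  refine List.map_congr_left fun e he => plurality_congr fun i hi => h i (hi.trans_le ?_)
  exact Nat.mul_le_mul_right _ (Nat.succ_le_of_lt (List.mem_range.1 he))

/-- At the first error the queried prefix is still correct, so the draws behind that vote have the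
tilted law; later votes need no analysis. -/
theorem exists_first_error {u : List (Fin K)} (x : ℕ → Fin K) (N n : ℕ) (hn : n ≤ u.length)
    (h : estPrefix x N n ≠ u.take n) :
    ∃ d, ∃ hd : d < u.length, d < n ∧ estPrefix x N d = u.take d ∧ plurality x N d ≠ u[d] := by
  induction n with
  | zero => exact absurd (by simp [estPrefix]) h
  | succ n ih =>
    by_cases hprev : estPrefix x N n = u.take n
    · refine ⟨n, hn, n.lt_succ_self, hprev, fun he => h ?_⟩
      rw [estPrefix_succ, hprev, he, List.take_append_getElem]
    · obtain ⟨d, hd, hdn, h1, h2⟩ := ih (by omega) hprev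
      exact ⟨d, hd, by omega, h1, h2⟩

/-- The product is `exp (λ/2 (#a - #c))`, and a winner `a` satisfies `#a ≥ #c`, ties included. -/
theorem one_le_prod_voteWeight {lam : ℝ} (hlam : 0 < lam) {x : ℕ → Fin K} {N d : ℕ} {c a : Fin K}
    (h : plurality x N d = a) :
    1 ≤ ∏ i ∈ Finset.Ico (d * N) ((d + 1) * N), voteWeight lam c a (x i) := by
  simp only [voteWeight]
  rw [← Real.exp_sum, Real.one_le_exp_iff, ← Finset.mul_sum, Finset.sum_sub_distrib,
    Finset.sum_boole, Finset.sum_boole]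
  have h1 := le_argmaxToken (blockCount x N d) c
  rw [show argmaxToken (blockCount x N d) = a from h] at h1
  have h2 : (blockCount x N d c : ℝ) ≤ blockCount x N d a := by exact_mod_cast h1
  exact mul_nonneg (by linarith) (sub_nonneg.2 h2)

end Tokens

theorem policy_ext {X : Type*} [MeasurableSpace X] {K H : ℕ} {π π' : Policy X K H} (h : ∀ x, π.resp x = π'.resp x) : π = π' := by
  cases π
  cases π'
  congr
  exact funext h

open scoped Classical in
/-- The reward bit read off the reply to the reward query for the bit `false`. -/
def replyBit {K H : ℕ} : Reply (Fin K) K H → Bool :=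
  Sum.elim (fun _ => false) (Sum.elim (fun o => decide (o.2 = 0)) fun _ => false)

theorem measurable_replyBit {K H : ℕ} : Measurable (replyBit (K := K) (H := H)) := by
  classical
  refine Measurable.sumElim measurable_const (Measurable.sumElim ?_ measurable_const)
  have h : (fun o : Resp K H × ℝ => decide (o.2 = 0)) =
      fun o => if o.2 = 0 then true else false := by
    funext o
    by_cases ho : o.2 = 0 <;> simp [ho]
  rw [h]
  exact Measurable.ite (measurable_snd (measurableSet_singleton 0)) measurable_const
    measurable_const

theorem measurableSet_replyBit {Ω : Type*} [MeasurableSpace Ω] {K H n : ℕ} (i : Fin n)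
    (t : Set Bool) : MeasurableSet {r : Ω × (Fin n → Reply (Fin K) K H) | replyBit (r.2 i) ∈ t} :=
  (measurable_replyBit.comp ((measurable_pi_apply i).comp measurable_snd)) MeasurableSet.of_discrete

/-! ### The local-reset learner and its error probability -/

section Learner

variable {X : Type*} [MeasurableSpace X] {K D L : ℕ} [NeZero K]

/-- The suffix read off the plurality votes. -/
def estSuffix (x : ℕ → Fin K) (N D L : ℕ) (i : Fin L) : Fin K := plurality x N (D + i)

theorem estSuffix_eq {x : ℕ → Fin K} {N : ℕ} {v : Fin D → Fin K} {s : Fin L → Fin K}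
    (h : estPrefix x N (D + L) = List.ofFn v ++ List.ofFn s) : estSuffix x N D L = s := by
  funext i
  have h1 := congrArg (fun l : List (Fin K) => l[D + i.1]?) h
  simpa [estPrefix, estSuffix, List.getElem?_append_right] using h1

theorem measurableSet_estPrefix_eq {Ω : Type*} [MeasurableSpace Ω] {H n : ℕ} (N d : ℕ)
    (u : List (Fin K)) : MeasurableSet
      {r : Ω × (Fin n → Reply (Fin K) K H) | estPrefix (tokens r.2) N d = u} :=
  measurableSet_setOfPred.2 (measurable_comp_tokens fun x => estPrefix x N d = u)

open scoped Classical in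
/-- The distribution concentrated at `z`. -/
def pointMass {α : Type*} [Fintype α] (z : α) : ProbDist α :=
  ⟨Pi.single z 1, single_mem_stdSimplex ℝ z⟩

theorem lintegral_pointMass {α B : Type*} [Fintype α] [MeasurableSpace B] (z : α)
    (μ : α → Measure B) (f : B → ℝ≥0∞) :
    ∫⁻ x, f x ∂(∑ y, ENNReal.ofReal ((pointMass z).1 y) • μ y) = ∫⁻ x, f x ∂μ z := by
  classical
  rw [lintegral_mixture, Finset.sum_eq_single z]
  · simp [pointMass]
  · intro y _ hy
    simp [pointMass, hy]
  · simp

theorem length_estPrefix_lt {x : ℕ → Fin K} {N n : ℕ} (h : n < (D + L) * N) :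
    (estPrefix x N (n / N)).length < D + L + 1 := by
  rw [length_estPrefix]
  have := Nat.div_lt_of_lt_mul (by rwa [mul_comm] at h : n < N * (D + L))
  omega

/-- The action of the learner in round `n`, given the tokens seen so far: in the first
`(D + L) N` rounds, `N` draws at each prefix of plurality votes; then one reward query. -/
def learnerAct (xs : X) (v : Fin D → Fin K) (τ : Bool → Fin K) (N n : ℕ) (x : ℕ → Fin K) :
    Action X (X × Prefix K (D + L + 1)) K (D + L + 1) :=
  if h : n < (D + L) * N then
    Sum.inl (xs, toPrefix (estPrefix x N (n / N)) (length_estPrefix_lt h))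
  else if n = (D + L) * N then
    Sum.inr (Sum.inl (xs, pointMass (target v τ (estSuffix x N D L) false)))
  else Sum.inr (Sum.inr ())

variable (lam : ℝ) {xs : X} (hxs : MeasurableSet {xs}) (easy : Generator X K (D + L + 1))
  (v : Fin D → Fin K) (τ : Bool → Fin K) (N : ℕ)

/-- The output of the learner: the Gibbs policy of the instance read off the transcript. -/
def learnerOutput (r : (Unit × (Fin ((D + L) * N + 1) → Reply (Fin K) K (D + L + 1))) × X) :
    ProbDist (Resp K (D + L + 1)) :=
  (hardOptimizer lam hxs easy v τ (estSuffix (tokens r.1.2) N D L)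
    (replyBit (r.1.2 (Fin.last _)))).resp r.2

theorem measurable_learnerOutput : Measurable (learnerOutput lam hxs easy v τ N) := by
  have h : Measurable fun p : ((Fin L → Fin K) × Bool) × X =>
      (hardOptimizer lam hxs easy v τ p.1.1 p.1.2).resp p.2 :=
    measurable_from_prod_countable_right fun p =>
      (hardOptimizer lam hxs easy v τ p.1 p.2).measurable_resp
  have h1 : Measurable fun r : Unit × (Fin ((D + L) * N + 1) →
      Reply (Fin K) K (D + L + 1)) => (estSuffix (tokens r.2) N D L : Fin L → Fin K) :=
    measurable_comp_tokens (β := Fin L → Fin K) fun x => estSuffix x N D L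
  have h2 : Measurable fun r : Unit × (Fin ((D + L) * N + 1) →
      Reply (Fin K) K (D + L + 1)) => replyBit (r.2 (Fin.last _)) :=
    measurable_replyBit.comp ((measurable_pi_apply _).comp measurable_snd)
  have h3 := h1.prodMk h2
  have h4 := h.comp ((h3.comp measurable_fst).prodMk measurable_snd)
  simp only [Function.comp_def] at h4
  unfold learnerOutput
  exact h4

/-- The local-reset learner. -/
def learner : Algorithm Unit X (X × Prefix K (D + L + 1)) (Fin K) K (D + L + 1) where
  seedLaw := Measure.dirac ()
  isProbabilityMeasure_seedLaw := inferInstance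
  rounds := (D + L) * N + 1
  act n r := learnerAct xs v τ N n (tokens r.2)
  measurable_act _ := measurable_comp_tokens _
  output := learnerOutput lam hxs easy v τ N
  measurable_output := measurable_learnerOutput lam hxs easy v τ N

theorem learner_policy (r : Unit × (Fin ((D + L) * N + 1) → Reply (Fin K) K (D + L + 1))) :
    (learner lam hxs easy v τ N).policy r =
      hardOptimizer lam hxs easy v τ (estSuffix (tokens r.2) N D L)
        (replyBit (r.2 (Fin.last _))) := by
  refine policy_ext fun x => ?_
  simp only [Algorithm.policy, learner, learnerOutput]

theorem learner_usesAtMost :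
    (learner lam hxs easy v τ N).UsesAtMost ((D + L) * N) 1 := by
  classical
  intro r
  constructor
  · rw [Algorithm.genCount, Nat.card_eq_fintype_card, Fintype.card_subtype]
    refine (Finset.card_le_card (t := Finset.univ.erase (Fin.last _)) fun n hn => ?_).trans ?_
    · obtain ⟨q, hq⟩ := (Finset.mem_filter.1 hn).2
      refine Finset.mem_erase.2 ⟨fun h => ?_, Finset.mem_univ _⟩
      subst h
      simp [Algorithm.actionAt, learner, learnerAct] at hq
    · rw [Finset.card_erase_of_mem (Finset.mem_univ _), Finset.card_univ, Fintype.card_fin]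
      rfl
  · rw [Algorithm.rewardCount, Nat.card_eq_fintype_card, Fintype.card_subtype]
    refine (Finset.card_le_card (t := {Fin.last _}) fun n hn => ?_).trans
      (Finset.card_singleton _).le
    obtain ⟨q, hq⟩ := (Finset.mem_filter.1 hn).2
    rw [Finset.mem_singleton]
    by_contra hne
    have hlt : n.1 < (D + L) * N := Fin.val_lt_last hne
    simp [Algorithm.actionAt, learner, learnerAct, hlt] at hq

/-- The prefix of block `k + 1` adds one vote to the prefix of block `k`, which was queried from
round `k * N` on; block 0 queries the empty prefix. -/
theorem learner_localReset : (learner lam hxs easy v τ N).LocalReset := by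
  intro r n x p h
  simp only [Algorithm.actionAt, learner, learnerAct] at h
  split_ifs at h with h1 h2
  · obtain ⟨rfl, hp⟩ := Prod.mk.inj (Sum.inl.inj h)
    have hN : 0 < N := by
      refine Nat.pos_of_ne_zero fun h0 => ?_
      simp [h0] at h1
    have hp1 : p.1 = estPrefix (tokens fun i => r.2 (Fin.castLE n.2.le i)) N (n.1 / N) := by
      rw [← hp]
      rfl
    rcases Nat.eq_zero_or_pos (n.1 / N) with h0 | hpos
    · left
      rw [hp1, h0]
      rfl
    · right
      obtain ⟨k, hk⟩ : ∃ k, n.1 / N = k + 1 := ⟨n.1 / N - 1, by omega⟩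
      have hkn : k * N < n.1 := by
        have := Nat.div_mul_le_self n.1 N
        rw [hk, Nat.succ_mul] at this
        omega
      have hkT : k * N < (D + L) * N := hkn.trans h1
      have hkr : k * N < (D + L) * N + 1 := by omega
      refine ⟨⟨k * N, hkr⟩, hkn,
        toPrefix (estPrefix (tokens fun i => r.2 (Fin.castLE hkr.le i)) N (k * N / N))
          (length_estPrefix_lt hkT), ?_, Or.inr ⟨plurality
        (tokens fun i => r.2 (Fin.castLE n.2.le i)) N k, ?_⟩⟩
      · simp only [Algorithm.actionAt, learner, learnerAct]
        rw [dif_pos hkT]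
      · rw [hp1, hk]
        simp only [toPrefix]
        rw [estPrefix_succ, Nat.mul_div_cancel _ hN]
        congr 1
        refine estPrefix_congr fun i hi => ?_
        rw [tokens_castLE r.2 n.2.le (hi.trans hkn), tokens_castLE r.2 hkr.le hi]

/-- The factor of the error potential at position `i` after `n` rounds. -/
def voteFactor (lam : ℝ) (c a : Fin K) (n : ℕ) (x : ℕ → Fin K) (i : ℕ) : ℝ≥0∞ :=
  if i < n then ENNReal.ofReal (voteWeight lam c a (x i)) else ENNReal.ofReal (voteRate K lam)

open scoped Classical in
/-- The error potential of the pair (depth `d`, wrong token `a`) for the hidden path `u`. -/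
def votePotential (lam : ℝ) (u : List (Fin K)) (c a : Fin K) (N d n : ℕ) (x : ℕ → Fin K) :
    ℝ≥0∞ :=
  if n ≤ d * N ∨ estPrefix x N d = u.take d then
    ∏ i ∈ Finset.Ico (d * N) ((d + 1) * N), voteFactor lam c a n x i else 0

variable (β : ℝ) (s : Fin L → Fin K) (b : Bool)

theorem lintegral_token_reply (R : Kernel (X × ProbDist (Resp K (D + L + 1)))
      (Resp K (D + L + 1) × ℝ)) (p : Prefix K (D + L + 1)) (g : Fin K → ℝ≥0∞) :
    ∫⁻ o, g (replyToken o) ∂replyKernel (prefixSample (hardGenerator lam hxs easy v s)) R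
        (Sum.inl (xs, p)) =
      ∑ c, ENNReal.ofReal ((hiddenPathNext lam (List.ofFn v ++ List.ofFn s) p).1 c) * g c := by
  rw [replyKernel_inl, lintegral_map (f := fun o => g (replyToken o))
    ((Measurable.of_discrete (f := g)).comp measurable_replyToken) measurable_inl]
  change ∫⁻ o, g o ∂massMeasure ((hardGenerator lam hxs easy v s).next xs p).1 = _
  rw [lintegral_massMeasure, hardGenerator_next_hard]

/-- Supermartingale property. Within block `d`, at a correct prefix, the draw replaces a factor
`voteRate` by a random weight of the same mean; outside the block no factor changes. -/
theorem lintegral_votePotential_step (hN : 0 < N) {d : ℕ}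
    {u : List (Fin K)} (hu : u = List.ofFn v ++ List.ofFn s) (hd : d < u.length) {a : Fin K}
    (ha : a ≠ u[d]) (R : Kernel (X × ProbDist (Resp K (D + L + 1)))
      (Resp K (D + L + 1) × ℝ)) [IsMarkovKernel R] (n : ℕ)
    (r : Unit × (Fin n → Reply (Fin K) K (D + L + 1))) :
    ∫⁻ o, votePotential lam u u[d] a N d
        (n + 1) (tokens (Fin.snoc r.2 o : Fin (n + 1) → Reply (Fin K) K (D + L + 1)))
        ∂replyKernel (prefixSample (hardGenerator lam hxs easy v s)) R
          ((learner lam hxs easy v τ N).act n r) ≤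
      votePotential lam u u[d] a N d n
        (tokens r.2) := by
  classical
  have hdDL : d < D + L := by simpa [hu] using hd
  have hNN : d * N < (d + 1) * N := Nat.mul_lt_mul_of_pos_right d.lt_succ_self hN
  have hest : ∀ o, d * N ≤ n →
      estPrefix (tokens (Fin.snoc r.2 o : Fin (n + 1) → Reply (Fin K) K (D + L + 1))) N d =
      estPrefix (tokens r.2) N d := fun o h =>
    estPrefix_congr fun i hi => tokens_snoc_of_lt r.2 o (hi.trans_le h)
  have hfac : ∀ o i, i ≠ n → voteFactor lam u[d] a (n + 1)
      (tokens (Fin.snoc r.2 o : Fin (n + 1) → Reply (Fin K) K (D + L + 1))) i =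
      voteFactor lam u[d] a n (tokens r.2) i := by
    intro o i hi
    simp only [voteFactor]
    by_cases hin : i < n
    · rw [if_pos hin, if_pos (by omega), tokens_snoc_of_lt r.2 o hin]
    · rw [if_neg hin, if_neg (by omega)]
  by_cases hblock : n ∈ Finset.Ico (d * N) ((d + 1) * N)
  · obtain ⟨hn1, hn2⟩ := Finset.mem_Ico.1 hblock
    have hnT : n < (D + L) * N := hn2.trans_le (Nat.mul_le_mul_right _ hdDL)
    have hnd : n / N = d := by
      exact Nat.div_eq_of_lt_le hn1 hn2
    by_cases hgood : estPrefix (tokens r.2) N d = u.take d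
    · have hact : (learner lam hxs easy v τ N).act n r =
          Sum.inl (xs, toPrefix (estPrefix (tokens r.2) N (n / N)) (length_estPrefix_lt hnT)) := by
        simp only [learner, learnerAct]
        rw [dif_pos hnT]
      have hnext : hiddenPathNext lam u (toPrefix (estPrefix (tokens r.2) N (n / N))
          (length_estPrefix_lt (D := D) (L := L) hnT)) = tilted lam u[d] :=
        hiddenPathNext_take lam u _ d (by simp only [toPrefix]; rw [hnd, hgood]) hd
      have hV : ∀ o, votePotential lam u u[d] a N d (n + 1)
          (tokens (Fin.snoc r.2 o : Fin (n + 1) → Reply (Fin K) K (D + L + 1))) =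
          ENNReal.ofReal (voteWeight lam u[d] a (replyToken o)) *
            ∏ i ∈ (Finset.Ico (d * N) ((d + 1) * N)).erase n,
              voteFactor lam u[d] a n (tokens r.2) i := by
        intro o
        rw [votePotential, if_pos (Or.inr ((hest o hn1).trans hgood)),
          ← Finset.mul_prod_erase _ _ hblock]
        congr 1
        · rw [voteFactor, if_pos n.lt_succ_self, tokens_snoc_self]
        · exact Finset.prod_congr rfl fun i hi => hfac o i (Finset.ne_of_mem_erase hi)
      refine (lintegral_congr hV).trans_le ?_
      rw [lintegral_mul_const (f := fun o => ENNReal.ofReal (voteWeight lam u[d] a (replyToken o))) _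
        ((Measurable.of_discrete (f := fun c : Fin K =>
        ENNReal.ofReal (voteWeight lam u[d] a c))).comp measurable_replyToken), hact,
        lintegral_token_reply lam hxs easy v s R _ fun c =>
          ENNReal.ofReal (voteWeight lam u[d] a c), ← hu, hnext]
      simp only [← ENNReal.ofReal_mul ((tilted lam u[d]).2.1 _)]
      rw [← ENNReal.ofReal_sum_of_nonneg fun c _ =>
        mul_nonneg ((tilted lam u[d]).2.1 _)
        (voteWeight_pos lam u[d] a c).le, sum_tilted_mul_voteWeight lam ha,
        votePotential, if_pos (Or.inr hgood), ← Finset.mul_prod_erase _ _ hblock]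
      refine le_of_eq ?_
      congr 1
      rw [voteFactor, if_neg (lt_irrefl n)]
    -- After an earlier error the potential drops to zero, so the law of these draws is irrelevant.
    · have hV : ∀ o, votePotential lam u u[d] a N d (n + 1)
          (tokens (Fin.snoc r.2 o : Fin (n + 1) → Reply (Fin K) K (D + L + 1))) = 0 := by
        intro o
        rw [votePotential, if_neg]
        rw [hest o hn1]
        exact not_or.2 ⟨by omega, hgood⟩
      exact (lintegral_congr hV).trans_le (by simp)
  · have hV : ∀ o, votePotential lam u u[d] a N d (n + 1)
        (tokens (Fin.snoc r.2 o : Fin (n + 1) → Reply (Fin K) K (D + L + 1))) =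
        votePotential lam u u[d] a N d n (tokens r.2) := by
      intro o
      have hprod : ∏ i ∈ Finset.Ico (d * N) ((d + 1) * N), voteFactor lam u[d] a (n + 1)
          (tokens (Fin.snoc r.2 o : Fin (n + 1) → Reply (Fin K) K (D + L + 1))) i =
          ∏ i ∈ Finset.Ico (d * N) ((d + 1) * N),
            voteFactor lam u[d] a n (tokens r.2) i :=
        Finset.prod_congr rfl fun i hi => hfac o i fun h => hblock (h ▸ hi)
      rw [votePotential, votePotential, hprod]
      rw [Finset.mem_Ico, not_and_or, not_le, not_lt] at hblock
      rcases hblock with h | h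
      · rw [if_pos (Or.inl (by omega)), if_pos (Or.inl (by omega))]
      · rw [hest o (by omega)]
        have h1 : ¬ n ≤ d * N := by omega
        have h2 : ¬ n + 1 ≤ d * N := by omega
        simp only [h1, h2, false_or]
    exact (lintegral_congr hV).trans_le (by rw [lintegral_const, measure_univ, mul_one])

/-- At time 0 the potential is deterministic: `N` factors, all equal to `voteRate`. -/
theorem lintegral_votePotential_le (hN : 0 < N) {d : ℕ}
    {u : List (Fin K)} (hu : u = List.ofFn v ++ List.ofFn s) (hd : d < u.length) {a : Fin K}
    (ha : a ≠ u[d]) (R : Kernel (X × ProbDist (Resp K (D + L + 1)))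
      (Resp K (D + L + 1) × ℝ)) [IsMarkovKernel R] (n : ℕ) :
    ∫⁻ r, votePotential lam u u[d] a N d n
        (tokens r.2) ∂(learner lam hxs easy v τ N).lawUpTo
          (prefixSample (hardGenerator lam hxs easy v s)) R n ≤
      ENNReal.ofReal (voteRate K lam) ^ N := by
  classical
  refine ((learner lam hxs easy v τ N).lintegral_lawUpTo_le _ _
    (fun n r => votePotential lam u u[d] a
      N d n (tokens r.2)) (fun n => measurable_comp_tokens _) n
    fun m _ r => lintegral_votePotential_step lam hxs easy v τ N s hN hu hd ha R m r).trans ?_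
  have hV : ∀ x : ℕ → Fin K, votePotential lam u u[d] a N d 0 x = ENNReal.ofReal (voteRate K lam) ^ N := by
    intro x
    rw [votePotential, if_pos (Or.inl (Nat.zero_le _))]
    simp only [voteFactor, Nat.not_lt_zero, if_false, Finset.prod_const, Nat.card_Ico]
    congr 1
    rw [Nat.succ_mul]
    omega
  simp only [hV, lintegral_const, measure_univ, mul_one, le_refl]

/-- The runs whose reward bit is misread although the path is right. -/
theorem prob_wrong_bit (hK : 2 ≤ K) (hβ : 0 < β) (hτ : τ false ≠ τ true)
    (G : Kernel (X × Prefix K (D + L + 1)) (Fin K)) [IsMarkovKernel G]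
: (learner lam hxs easy v τ N).lawUpTo G
        (rewardOracle (hardInstance lam β hxs easy v τ s b)) ((D + L) * N + 1)
      {r | estPrefix (tokens r.2) N (D + L) = List.ofFn v ++ List.ofFn s ∧
        replyBit (r.2 (Fin.last _)) ≠ b} = 0 := by
  classical
  set bad : Set (Unit × (Fin ((D + L) * N + 1) → Reply (Fin K) K (D + L + 1))) :=
    {r | estPrefix (tokens r.2) N (D + L) = List.ofFn v ++ List.ofFn s ∧
      replyBit (r.2 (Fin.last _)) ≠ b} with hbad
  have hmeas : MeasurableSet bad :=
    (measurableSet_estPrefix_eq N (D + L) (List.ofFn v ++ List.ofFn s)).inter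
      (measurableSet_replyBit _ {c | c ≠ b})
  have hind : Measurable (bad.indicator fun _ => (1 : ℝ≥0∞)) := measurable_const.indicator hmeas
  rw [← lintegral_indicator_one hmeas]
  change ∫⁻ r, bad.indicator (fun _ => (1 : ℝ≥0∞)) r ∂_ = 0
  rw [(learner lam hxs easy v τ N).lintegral_lawUpTo_succ _ _ _ hind,
    lintegral_eq_zero_iff ((learner lam hxs easy v τ N).measurable_lintegral_step _ _ _ hind)]
  refine Filter.Eventually.of_forall fun r => ?_
  have hact : (learner lam hxs easy v τ N).act ((D + L) * N) r = Sum.inr (Sum.inl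
      (xs, pointMass (target v τ (estSuffix (tokens r.2) N D L) false))) := by
    simp [learner, learnerAct]
  have hsnoc : Measurable fun o : Reply (Fin K) K (D + L + 1) =>
      bad.indicator (fun _ => (1 : ℝ≥0∞)) (r.1, Fin.snoc r.2 o) :=
    hind.comp ((Algorithm.measurable_snoc_reply _).comp measurable_prodMk_left)
  have hstep : Measurable fun o : Resp K (D + L + 1) × ℝ =>
      bad.indicator (fun _ => (1 : ℝ≥0∞)) (r.1, Fin.snoc r.2 (Sum.inr (Sum.inl o))) :=
    hsnoc.comp measurable_rewardReply
  rw [Pi.zero_apply]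
  beta_reduce
  rw [hact, replyKernel_reward, lintegral_map hsnoc measurable_rewardReply]
  -- The query names a point mass, so completion and reward are determined by the earlier tokens.
  refine (lintegral_pointMass (target v τ (estSuffix (tokens r.2) N D L) false) _ _).trans ?_
  rw [lintegral_dirac' _ hstep]
  refine Set.indicator_of_notMem (fun hmem => ?_) _
  obtain ⟨h1, h2⟩ := hmem
  apply h2
  have hest : estPrefix (tokens r.2) N (D + L) = List.ofFn v ++ List.ofFn s := by
    rw [← h1]
    exact estPrefix_congr fun i hi => (tokens_snoc_of_lt r.2 _ hi).symm
  rw [estSuffix_eq hest]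
  have hR := rewardScale_pos K D L hK lam hβ
  dsimp only
  rw [Fin.snoc_last (α := fun _ => Reply (Fin K) K (D + L + 1))]
  -- The guess carries the bit `false`: it earns `R ≠ 0` if `b` is `false`, and 0 if `b` is `true`,
  -- as the last tokens then differ.
  cases b with
  | false => simp [replyBit, hardInstance, hR.ne']
  | true =>
    have hne : target v τ s false ≠ target v τ s true := fun h => hτ (by
      simpa [target] using congrFun h (Fin.last _))
    simp [replyBit, hardInstance, hne]

/-- Union bound over the depth of the first error and the token that wins there. On each such event
the final potential is at least 1, so Markov's inequality applies. -/
theorem prob_wrong_path_le (hlam : 0 < lam) (hN : 0 < N)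
    (R : Kernel (X × ProbDist (Resp K (D + L + 1))) (Resp K (D + L + 1) × ℝ)) [IsMarkovKernel R] :
    (learner lam hxs easy v τ N).lawUpTo (prefixSample (hardGenerator lam hxs easy v s)) R
      ((D + L) * N + 1) {r | estPrefix (tokens r.2) N (D + L) ≠ List.ofFn v ++ List.ofFn s} ≤
      (D + L : ℕ) * (K * ENNReal.ofReal (voteRate K lam) ^ N) := by
  classical
  set u := List.ofFn v ++ List.ofFn s with hu
  have hlen : u.length = D + L := by simp [hu]
  set P := (learner lam hxs easy v τ N).lawUpTo (prefixSample (hardGenerator lam hxs easy v s)) R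
    ((D + L) * N + 1) with hP
  set E : Fin u.length → Fin K → Set (Unit × (Fin ((D + L) * N + 1) →
      Reply (Fin K) K (D + L + 1))) := fun d a =>
    {r | a ≠ u[d.1] ∧ estPrefix (tokens r.2) N d = u.take d ∧ plurality (tokens r.2) N d = a} with hE
  have hsub : {r : Unit × (Fin ((D + L) * N + 1) → Reply (Fin K) K (D + L + 1)) |
      estPrefix (tokens r.2) N (D + L) ≠ u} ⊆ ⋃ d, ⋃ a, E d a := by
    intro r hr
    obtain ⟨d, hd, -, h1, h2⟩ := exists_first_error (u := u) (tokens r.2) N (D + L) hlen.ge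
      (by rwa [List.take_of_length_le hlen.le])
    exact Set.mem_iUnion₂.2 ⟨⟨d, hd⟩, _, h2, h1, rfl⟩
  have hEle : ∀ d a, P (E d a) ≤ ENNReal.ofReal (voteRate K lam) ^ N := by
    intro d a
    by_cases ha : a = u[d.1]
    · have : E d a = ∅ := by
        ext r
        simp [hE, ha]
      simp [this]
    · refine le_trans ?_ (lintegral_votePotential_le lam hxs easy v τ N s hN hu d.2 ha R
        ((D + L) * N + 1))
      have h1 := mul_meas_ge_le_lintegral (μ := P) (f := fun r => votePotential lam u u[d.1] a N d
        ((D + L) * N + 1) (tokens r.2)) (measurable_comp_tokens _) 1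
      rw [one_mul] at h1
      refine le_trans (measure_mono fun r hr => ?_) h1
      obtain ⟨-, h2, h3⟩ := hr
      change (1 : ℝ≥0∞) ≤ votePotential lam u u[d.1] a N d ((D + L) * N + 1) (tokens r.2)
      rw [votePotential, if_pos (Or.inr h2)]
      have hbound : (d.1 + 1) * N ≤ (D + L) * N :=
        Nat.mul_le_mul_right _ (by have := d.2; omega)
      have h4 : ∀ i ∈ Finset.Ico (d.1 * N) ((d.1 + 1) * N), voteFactor lam u[d.1] a
          ((D + L) * N + 1) (tokens r.2) i =
          ENNReal.ofReal (voteWeight lam u[d.1] a (tokens r.2 i)) := by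
        intro i hi
        rw [voteFactor, if_pos (by have := (Finset.mem_Ico.1 hi).2; omega)]
      rw [Finset.prod_congr rfl h4, ← ENNReal.ofReal_prod_of_nonneg fun i _ =>
        (voteWeight_pos _ _ _ _).le, ← ENNReal.ofReal_one]
      exact ENNReal.ofReal_le_ofReal (one_le_prod_voteWeight hlam h3)
  calc P {r | estPrefix (tokens r.2) N (D + L) ≠ u} ≤ P (⋃ d, ⋃ a, E d a) := measure_mono hsub
    _ ≤ ∑ d, ∑ a, P (E d a) := (measure_iUnion_fintype_le _ _).trans
        (Finset.sum_le_sum fun d _ => measure_iUnion_fintype_le _ _)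
    _ ≤ ∑ _d : Fin u.length, ∑ _a : Fin K, ENNReal.ofReal (voteRate K lam) ^ N :=
        Finset.sum_le_sum fun d _ => Finset.sum_le_sum fun a _ => hEle d a
    _ = _ := by simp [hlen]

/-- The learner outputs an exact optimizer with high probability. -/
theorem learner_success (hK : 2 ≤ K) (hlam : 0 < lam) (hβ : 0 < β) (hτ : τ false ≠ τ true)
    (hN : 0 < N) (ρ : Measure X) [IsProbabilityMeasure ρ] :
    1 - (D + L : ℕ) * (K * voteRate K lam ^ N) ≤
      ((learner lam hxs easy v τ N).law (prefixSample (hardInstance lam β hxs easy v τ s b).base)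
        (rewardOracle (hardInstance lam β hxs easy v τ s b))).real
      {run | (hardInstance lam β hxs easy v τ s b).IsOptimizer ρ β
        ((learner lam hxs easy v τ N).policy run)} := by
  classical
  set P := (learner lam hxs easy v τ N).lawUpTo (prefixSample (hardGenerator lam hxs easy v s))
    (rewardOracle (hardInstance lam β hxs easy v τ s b)) ((D + L) * N + 1) with hP
  set good : Set (Unit × (Fin ((D + L) * N + 1) → Reply (Fin K) K (D + L + 1))) :=
    {r | estPrefix (tokens r.2) N (D + L) = List.ofFn v ++ List.ofFn s ∧
      replyBit (r.2 (Fin.last _)) = b} with hgood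
  have hmeas : MeasurableSet good :=
    (measurableSet_estPrefix_eq N (D + L) (List.ofFn v ++ List.ofFn s)).inter
      (measurableSet_replyBit _ {c | c = b})
  have hcompl : P goodᶜ ≤ ENNReal.ofReal ((D + L : ℕ) * (K * voteRate K lam ^ N)) := by
    have hsub : goodᶜ ⊆ {r | estPrefix (tokens r.2) N (D + L) ≠ List.ofFn v ++ List.ofFn s} ∪
        {r | estPrefix (tokens r.2) N (D + L) = List.ofFn v ++ List.ofFn s ∧
          replyBit (r.2 (Fin.last _)) ≠ b} := by
      intro r hr
      by_cases h : estPrefix (tokens r.2) N (D + L) = List.ofFn v ++ List.ofFn s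
      · exact Or.inr ⟨h, fun hb => hr ⟨h, hb⟩⟩
      · exact Or.inl h
    refine (measure_mono hsub).trans ((measure_union_le _ _).trans ?_)
    rw [prob_wrong_bit lam hxs easy v τ N β s b hK hβ hτ, add_zero]
    refine (prob_wrong_path_le lam hxs easy v τ N s hlam hN _).trans (le_of_eq ?_)
    rw [ENNReal.ofReal_mul (Nat.cast_nonneg _), ENNReal.ofReal_mul (Nat.cast_nonneg _),
      ENNReal.ofReal_pow (voteRate_pos hK lam).le, ENNReal.ofReal_natCast, ENNReal.ofReal_natCast]
  have hreal : P.real goodᶜ ≤ (D + L : ℕ) * (K * voteRate K lam ^ N) :=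
    ENNReal.toReal_le_of_le_ofReal (by have := voteRate_pos hK lam; positivity) hcompl
  have hsplit := probReal_add_probReal_compl (μ := P) hmeas
  have hsucc : P.real good ≤ P.real {run | (hardInstance lam β hxs easy v τ s b).IsOptimizer ρ β
      ((learner lam hxs easy v τ N).policy run)} := by
    refine measureReal_mono fun r hr => ?_
    have h1 : (learner lam hxs easy v τ N).policy r = hardOptimizer lam hxs easy v τ s b := by
      rw [learner_policy, estSuffix_eq hr.1, hr.2]
    change (hardInstance lam β hxs easy v τ s b).IsOptimizer ρ β _
    rw [h1]
    exact hardOptimizer_isOptimizer lam β hxs easy v τ s b ρ hβ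
  refine le_trans ?_ hsucc
  linarith

end Learner

/-! ### Choice of the constants -/

/-- `N` is `log (K H / δ) / log (1 / r)` rounded up. From `H ≥ 3 > e` one gets `log (H / δ) ≥ 1`,
which absorbs `log K` and the rounding into the constant. -/
theorem exists_blockLength {K H : ℕ} (hK : 2 ≤ K) {lam : ℝ} (hlam : 0 < lam) (hH : 3 ≤ H) {δ : ℝ}
    (hδ : 0 < δ) (hδ1 : δ < 1) :
    ∃ N : ℕ, 0 < N ∧ H * (K * voteRate K lam ^ N) ≤ δ ∧
      (H * N : ℝ) ≤ ((1 + Real.log K) / Real.log (1 / voteRate K lam) + 1) *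
        (H * Real.log (H / δ)) := by
  have hr := voteRate_pos hK lam
  have hr1 := voteRate_lt_one hK hlam
  set r := voteRate K lam
  have hlr : 0 < Real.log (1 / r) := Real.log_pos (by rw [lt_div_iff₀ hr]; linarith)
  have hK2 : (2 : ℝ) ≤ K := by exact_mod_cast hK
  have hH3 : (3 : ℝ) ≤ H := by exact_mod_cast hH
  have hHδ : (3 : ℝ) ≤ H / δ := by
    rw [le_div_iff₀ hδ]
    nlinarith
  have hlog : 1 ≤ Real.log (H / δ) := by
    rw [Real.le_log_iff_exp_le (by linarith)]
    linarith [Real.exp_one_lt_d9]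
  have hlogK : 0 < Real.log K := Real.log_pos (by linarith)
  have hKH : Real.log (K * (H / δ)) = Real.log K + Real.log (H / δ) :=
    Real.log_mul (by linarith) (by linarith)
  have hq : 0 < Real.log (K * (H / δ)) / Real.log (1 / r) := div_pos (by linarith) hlr
  refine ⟨⌈Real.log (K * (H / δ)) / Real.log (1 / r)⌉₊, Nat.ceil_pos.2 hq, ?_, ?_⟩
  · set N := ⌈Real.log (K * (H / δ)) / Real.log (1 / r)⌉₊
    have hN : Real.log (K * (H / δ)) / Real.log (1 / r) ≤ N := Nat.le_ceil _
    rw [div_le_iff₀ hlr] at hN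
    have hpow : r ^ N ≤ (K * (H / δ))⁻¹ := by
      rw [← Real.log_le_log_iff (pow_pos hr N) (by positivity), Real.log_inv, Real.log_pow]
      rw [one_div, Real.log_inv] at hN
      linarith
    calc (H : ℝ) * (K * r ^ N) ≤ H * (K * (K * (H / δ))⁻¹) := by gcongr
      _ = δ := by field_simp
  · have hN := (Nat.ceil_lt_add_one hq.le).le
    have h1 : Real.log (K * (H / δ)) / Real.log (1 / r) + 1 ≤
        ((1 + Real.log K) / Real.log (1 / r) + 1) * Real.log (H / δ) := by
      rw [hKH, add_mul, one_mul, div_mul_eq_mul_div]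
      refine add_le_add (div_le_div_of_nonneg_right ?_ hlr.le) hlog
      nlinarith
    calc (H : ℝ) * (⌈Real.log (K * (H / δ)) / Real.log (1 / r)⌉₊ : ℕ)
        ≤ H * (((1 + Real.log K) / Real.log (1 / r) + 1) * Real.log (H / δ)) :=
          mul_le_mul_of_nonneg_left (hN.trans h1) (by linarith)
      _ = _ := by ring

/-- The term `4 + qr` uses at most half of `(2/3) K ^ L`, so `1/3 ≤ qg * p ^ D`. Passing from `2 * D
+ 1` to `H` in the exponent of `√p` costs the factor `√p` in the constant. -/
theorem queries_lower_bound {p : ℝ} (hp : 0 < p) (hp1 : p < 1) {D L K H qg qr : ℕ}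
    (hKL : 3 * (4 + qr) ≤ (K : ℝ) ^ L) (hH : H ≤ 2 * D + 1)
    (h : (K : ℝ) ^ L * (2 / 3) ≤ 4 + (qg * ((K : ℝ) ^ L * p ^ D) + qr)) :
    Real.sqrt p / 3 * (Real.sqrt p)⁻¹ ^ H ≤ qg := by
  have hs : 0 < Real.sqrt p := Real.sqrt_pos.2 hp
  have hs1 : Real.sqrt p ≤ 1 := Real.sqrt_le_one.2 hp1.le
  have hqr : (0 : ℝ) ≤ qr := Nat.cast_nonneg _
  have hKL0 : 0 < (K : ℝ) ^ L := by linarith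
  have h1 : 1 / 3 ≤ qg * p ^ D := by
    have h2 : (K : ℝ) ^ L * (1 / 3) ≤ K ^ L * (qg * p ^ D) := by nlinarith
    exact le_of_mul_le_mul_left h2 hKL0
  have h3 : (Real.sqrt p)⁻¹ ^ H ≤ (Real.sqrt p)⁻¹ ^ (2 * D + 1) :=
    pow_le_pow_right₀ ((one_le_inv₀ hs).2 hs1) hH
  have h4 : (Real.sqrt p)⁻¹ ^ (2 * D + 1) = (Real.sqrt p)⁻¹ * (p ^ D)⁻¹ := by
    rw [pow_succ, pow_mul, inv_pow, Real.sq_sqrt hp.le, inv_pow, mul_comm]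
  have hpD : 0 < p ^ D := pow_pos hp D
  calc Real.sqrt p / 3 * (Real.sqrt p)⁻¹ ^ H
      ≤ Real.sqrt p / 3 * ((Real.sqrt p)⁻¹ * (p ^ D)⁻¹) := by
        rw [← h4]
        exact mul_le_mul_of_nonneg_left h3 (by positivity)
    _ = 1 / 3 * (p ^ D)⁻¹ := by field_simp
    _ ≤ qg * p ^ D * (p ^ D)⁻¹ := mul_le_mul_of_nonneg_right h1 (inv_pos.2 hpD).le
    _ = qg := by field_simp

theorem le_pow_of_two_le {K L n : ℕ} (hK : 2 ≤ K) (hn : n ≤ L) : (n : ℝ) ≤ (K : ℝ) ^ L := by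
  have h : n ≤ K ^ L := hn.trans (Nat.lt_pow_self (by omega)).le
  exact_mod_cast h

end GenAccess

end

theorem corollary4 (K : ℕ) [NeZero K] (hK : 2 ≤ K) (lam : ℝ) (hlam : 0 < lam) :
    ∃ c : ℝ, 1 < c ∧ ∃ C : ℝ, 0 < C ∧ ∃ a : ℝ, 0 < a ∧
    ∀ β : ℝ, 0 < β → ∀ qr : ℕ, 1 ≤ qr →
    ∃ H₀ : ℕ, ∀ H : ℕ, H₀ ≤ H →
    ∃ D L : ℕ, 1 ≤ D ∧ 1 ≤ L ∧ D + L + 1 = H ∧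
    ∀ (X : Type*) [MeasurableSpace X] (ρ : Measure X) [IsProbabilityMeasure ρ]
      (xs : X) (hxs : MeasurableSet {xs}), 0 < ρ.real {xs} →
    ∀ (easy : Generator X K (D + L + 1)) (v : Fin D → Fin K) (τ : Bool → Fin K),
      τ false ≠ τ true →
    -- chosen-prefix next-token sampling, under the local-reset discipline
    (∀ δ : ℝ, 0 < δ → δ < 1 →
      ∃ g : ℕ, (g : ℝ) ≤ C * (H * Real.log (H / δ)) ∧
      ∃ (Ω : Type) (_ : MeasurableSpace Ω)
        (A : Algorithm Ω X (X × Prefix K (D + L + 1)) (Fin K) K (D + L + 1)),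
        A.UsesAtMost g 1 ∧ A.LocalReset ∧
        ∀ (s : Fin L → Fin K) (b : Bool),
          let I := hardInstance lam β hxs easy v τ s b
          1 - δ ≤ (A.law (prefixSample I.base) (rewardOracle I)).real
            {run | I.IsOptimizer ρ β (A.policy run)}) ∧
    -- no-reset access
    (∀ (Q Y : Type*) [MeasurableSpace Q] [MeasurableSpace Y]
      (Γ : Kernel (X × Q × Resp K (D + L + 1) × (Fin (D + L + 1) → ProbDist (Fin K))) Y)
      [IsMarkovKernel Γ]
      (Ω : Type*) [MeasurableSpace Ω] (A : Algorithm Ω X (X × Q) Y K (D + L + 1)) (qg : ℕ),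
      A.UsesAtMost qg qr →
      (∀ (s : Fin L → Fin K) (b : Bool),
        let I := hardInstance lam β hxs easy v τ s b
        2 / 3 ≤ (A.law (noReset Γ I.base) (rewardOracle I)).real
          {run | I.regret ρ β (A.policy run) ≤ ((ρ.real {xs} * β / 4 : ℝ) : EReal)}) →
      a * c ^ H ≤ (qg : ℝ)) := by
  have hp := pPlus_pos (K := K) lam
  have hp1 := pPlus_lt_one hK lam
  have hs : 0 < Real.sqrt (pPlus K lam) := Real.sqrt_pos.2 hp
  have hs1 : Real.sqrt (pPlus K lam) < 1 := by
    rw [Real.sqrt_lt' one_pos]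
    simpa using hp1
  have hlr : 0 < Real.log (1 / voteRate K lam) := Real.log_pos (by
    rw [lt_div_iff₀ (voteRate_pos hK lam)]
    linarith [voteRate_lt_one hK hlam])
  have hlogK : 0 < Real.log K := Real.log_pos (by exact_mod_cast (by omega : 1 < K))
  refine ⟨(Real.sqrt (pPlus K lam))⁻¹, (one_lt_inv₀ hs).2 hs1,
    (1 + Real.log K) / Real.log (1 / voteRate K lam) + 1, by positivity,
    Real.sqrt (pPlus K lam) / 3, by positivity, ?_⟩
  intro β hβ qr hqr
  -- The horizon is split in half: `D` drives the exponential rate, while `L ≥ 3 (4 + qr)` already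
  -- gives `K ^ L ≥ 3 (4 + qr)`.
  refine ⟨2 * (3 * (4 + qr)) + 4, fun H hH => ⟨H / 2, H - 1 - H / 2, by omega, by omega, by omega,
    ?_⟩⟩
  have hHD : H ≤ 2 * (H / 2) + 1 := by omega
  have hHL : 3 * (4 + qr) ≤ H - 1 - H / 2 := by omega
  have hsum : H / 2 + (H - 1 - H / 2) ≤ H := by omega
  generalize H / 2 = D at *
  generalize H - 1 - D = L at *
  intro X _ ρ _ xs hxs hη easy v τ hτ
  refine ⟨fun δ hδ hδ1 => ?_, ?_⟩
  · obtain ⟨N, hN, hNδ, hNC⟩ := exists_blockLength (H := H) hK hlam (by omega) hδ hδ1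
    have hsum' : ((D + L : ℕ) : ℝ) ≤ H := by exact_mod_cast hsum
    refine ⟨(D + L) * N, ?_, Unit, inferInstance, learner lam hxs easy v τ N,
      learner_usesAtMost lam hxs easy v τ N, learner_localReset lam hxs easy v τ N,
      fun s b => ?_⟩
    · refine le_trans ?_ hNC
      rw [Nat.cast_mul]
      exact mul_le_mul_of_nonneg_right hsum' (Nat.cast_nonneg _)
    · refine le_trans ?_ (learner_success lam hxs easy v τ N β s b hK hlam hβ hτ hN ρ)
      have hnn : 0 ≤ (K : ℝ) * voteRate K lam ^ N :=
        mul_nonneg (Nat.cast_nonneg _) (pow_nonneg (voteRate_pos hK lam).le _)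
      linarith [mul_le_mul_of_nonneg_right hsum' hnn]
  · intro Q Y _ _ Γ _ Ω _ A qg hA hsucc
    refine queries_lower_bound hp hp1 (D := D) (L := L) (qr := qr) (K := K) ?_ hHD
      -- The instances with bit `false` suffice: the hardness lies in the suffix, not in the bit.
      (two_thirds_mul_le_of_noReset lam β hxs easy v τ Γ hK hβ ρ hη A hA fun s => hsucc s false)
    exact_mod_cast le_pow_of_two_le hK hHL
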